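/- Let $\zeta=e^{2\pi i/5}$, $\tau=\frac{1+\sqrt5}{2}$ and $K=\mathbb{Q}(\sqrt5)$, with Dedekind zeta function $\zeta_K$. Let $\sigma$ be the automorphism of $\mathbb{Q}(\zeta)$ with $\sigma(\zeta)=\zeta^2$, and let $\kappa:\mathbb{Z}[\zeta]\to\mathbb{Z}/5\mathbb{Z}$ be the ring homomorphism with $\kappa(\zeta)=1$. Let $\mathcal{W}_1\subset\mathbb{C}$ be the interior of the convex hull of $\{1,\zeta,\zeta^2,\zeta^3,\zeta^4\}$. For $\epsilon\in\mathbb{C}$ put $\mathcal{W}_{1,\epsilon}=\mathcal{W}_1+\epsilon$, $\mathcal{W}_{2,\epsilon}=-\tau\mathcal{W}_1+\epsilon$, $\mathcal{W}_{3,\epsilon}=\tau\mathcal{W}_1+\epsilon$, $\mathcal{W}_{4,\epsilon}=-\mathcal{W}_1+\epsilon$, and $$\mathcal{P}_\epsilon=\bigcup_{k=1}^4\{x\in\mathbb{Z}[\zeta] : \kappa(x)=k,\ \sigma(x)\in\mathcal{W}_{k,\epsilon}\}\subset\mathbb{C}=\mathbb{R}^2 .$$ For $\mathcal{P}\subset\mathbb{C}$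 let $\widehat{\mathcal{P}}=\{x\in\mathcal{P} : tx\notin\mathcal{P}\text{ for all }t\in(0,1)\}$ be the set of points of $\mathcal{P}$ visible from the origin. A locally finite set $\mathcal{Q}\subset\mathbb{C}$ has density $\theta(\mathcal{Q})$ if $\lim_{T\to\infty}\frac{\#(\mathcal{Q}\cap TD)}{\mathrm{vol}(TD)}=\theta(\mathcal{Q})$ for every Jordan measurable $D\subset\mathbb{C}$ with $\mathrm{vol}(D)>0$. **Theorem.** For every $\epsilon\in\mathbb{C}$ with $|\epsilon|<0.1$, the set $\widehat{\mathcal{P}_\epsilon}$ is locally finite, its density exists, and $$\theta(\widehat{\mathcal{P}_\epsilon})=\frac{(3+\tau)\,\mathrm{vol}(\mathcal{W}_1)-\mathrm{vol}\big(\mathcal{W}_1\cap(\mathcal{W}_1+\tau\epsilon)\big)}{3(\tau+2)\,\zeta_K(2)} .$$ -/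

import Mathlib

open MeasureTheory Filter Topology Polynomial
open scoped Pointwise IntermediateField

noncomputable section

namespace PenroseVisible

/-! ### Visible points and asymptotic density in the plane `ℂ = ℝ²` -/

/-- The subset of the points of `P` that are visible from the origin. -/
def visible (P : Set ℂ) : Set ℂ :=
  {x ∈ P | ∀ t : ℝ, 0 < t → t < 1 → (t : ℂ) * x ∉ P}

/-- A point set is locally finite if every bounded region contains finitely many of its points. -/
def LocFinite (P : Set ℂ) : Prop :=
  ∀ B : Set ℂ, Bornology.IsBounded B → (P ∩ B).Finite

/-- Jordan measurable sets: bounded sets whose boundary has Lebesgue measure zero. -/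
def JordanMeasurable (D : Set ℂ) : Prop :=
  Bornology.IsBounded D ∧ volume (frontier D) = 0

/-- `P` is locally finite and has asymptotic density `θ`: for every Jordan measurable `D` of
positive area, `#(P ∩ T D) / vol(T D) → θ` as `T → ∞`. -/
def HasDensity (P : Set ℂ) (θ : ℝ) : Prop :=
  LocFinite P ∧
    ∀ D : Set ℂ, JordanMeasurable D → 0 < volume D →
      Tendsto (fun T : ℝ => ((P ∩ T • D).ncard : ℝ) / (volume (T • D)).toReal) atTop (𝓝 θ)

/-! ### The ring `ℤ[ζ]`, `ζ = exp(2πi/5)`, and its homomorphisms `σ` and `κ` -/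

/-- `ζ = exp(2πi/5)`. -/
def zeta5 : ℂ := Complex.exp (2 * Real.pi * Complex.I / (5 : ℕ))

theorem zeta5_isPrimitiveRoot : IsPrimitiveRoot zeta5 5 :=
  Complex.isPrimitiveRoot_exp 5 (by norm_num)

theorem zeta5_isIntegral : IsIntegral ℤ zeta5 :=
  zeta5_isPrimitiveRoot.isIntegral (by norm_num)

/-- The subring `ℤ[ζ]` of `ℂ`. -/
abbrev ZZeta : Subalgebra ℤ ℂ := Algebra.adjoin ℤ {zeta5}

/-- `ζ` as an element of `ℤ[ζ]`. -/
def zetaGen : ZZeta := ⟨zeta5, Algebra.subset_adjoin (Set.mem_singleton zeta5)⟩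

/-- The power basis `1, ζ, ζ², ζ³` of `ℤ[ζ]`. -/
def zetaBasis : PowerBasis ℤ ZZeta := Algebra.adjoin.powerBasis' zeta5_isIntegral

theorem zetaBasis_gen : zetaBasis.gen = zetaGen :=
  Algebra.adjoin.powerBasis'_gen zeta5_isIntegral

theorem minpoly_zetaBasis_gen : minpoly ℤ zetaBasis.gen = cyclotomic 5 ℤ := by
  rw [cyclotomic_eq_minpoly zeta5_isPrimitiveRoot (by norm_num), zetaBasis_gen]
  exact (minpoly.algebraMap_eq (B := ZZeta) (B' := ℂ) Subtype.val_injective zetaGen).symm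

theorem aeval_cyclotomic_five {R : Type*} [CommRing R] (x : R) :
    aeval x (cyclotomic 5 ℤ) = 1 + x + x ^ 2 + x ^ 3 + x ^ 4 := by
  have : Fact (Nat.Prime 5) := ⟨by norm_num⟩
  rw [cyclotomic_prime]
  simp [Finset.sum_range_succ]

/-- The embedding `σ : ℤ[ζ] → ℂ` determined by `σ(ζ) = ζ²`, that is, the restriction to `ℤ[ζ]`
of the field automorphism `ζ ↦ ζ²` of `ℚ(ζ)`. -/
def sigma : ZZeta →ₐ[ℤ] ℂ :=
  zetaBasis.lift (zeta5 ^ 2) (by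
    rw [minpoly_zetaBasis_gen]
    have h : IsPrimitiveRoot (zeta5 ^ 2) 5 :=
      zeta5_isPrimitiveRoot.pow_of_coprime 2 (by norm_num)
    rw [cyclotomic_eq_minpoly h (by norm_num)]
    exact minpoly.aeval ℤ (zeta5 ^ 2))

theorem sigma_zetaGen : sigma zetaGen = zeta5 ^ 2 := by
  rw [← zetaBasis_gen]
  exact zetaBasis.lift_gen _ _

/-- The ring homomorphism `κ : ℤ[ζ] → ℤ/5ℤ` determined by `κ(ζ) = 1`. -/
def kappa : ZZeta →ₐ[ℤ] ZMod 5 :=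
  zetaBasis.lift 1 (by
    rw [minpoly_zetaBasis_gen, aeval_cyclotomic_five]
    decide)

theorem kappa_zetaGen : kappa zetaGen = 1 := by
  rw [← zetaBasis_gen]
  exact zetaBasis.lift_gen _ _

/-! ### The windows and the `𝒫`-sets -/

/-- The golden ratio `τ = (1 + √5) / 2`. -/
abbrev tau : ℝ := Real.goldenRatio

/-- The open regular pentagon `𝒲₁` with vertices `1, ζ, ζ², ζ³, ζ⁴`. -/
def pentagon : Set ℂ :=
  interior (convexHull ℝ {1, zeta5, zeta5 ^ 2, zeta5 ^ 3, zeta5 ^ 4})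

/-- The factors `1, -τ, τ, -1` by which `𝒲₁` is scaled for `k = 1, 2, 3, 4`
(the value at other `k` is never used). -/
def windowScale : ℕ → ℝ
  | 1 => 1
  | 2 => -tau
  | 3 => tau
  | 4 => -1
  | _ => 0

/-- The window `𝒲_{k,ε} = windowScale k · 𝒲₁ + ε`. -/
def window (k : ℕ) (ε : ℂ) : Set ℂ :=
  (fun w : ℂ => (windowScale k : ℂ) * w + ε) '' pentagon

/-- `Λ_{k,ε} = {x ∈ ℤ[ζ] | κ(x) = k, σ(x) ∈ 𝒲_{k,ε}}`, as a set of points of the plane. -/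
def lambdaSet (k : ℕ) (ε : ℂ) : Set ℂ :=
  {z : ℂ | ∃ x : ZZeta, (x : ℂ) = z ∧ kappa x = (k : ZMod 5) ∧ sigma x ∈ window k ε}

/-- The set `𝒫_ε = Λ_{1,ε} ∪ Λ_{2,ε} ∪ Λ_{3,ε} ∪ Λ_{4,ε}`. -/
def penroseSet (ε : ℂ) : Set ℂ := ⋃ k ∈ Finset.Icc 1 4, lambdaSet k ε

/-! ### The field `ℚ(√5)` -/

/-- The field `K = ℚ(√5) ⊆ ℝ`. -/
abbrev QSqrtFive : IntermediateField ℚ ℝ := ℚ⟮(√5 : ℝ)⟯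

theorem sqrtFive_isIntegral : IsIntegral ℚ (√5 : ℝ) := by
  refine ⟨X ^ 2 - C 5, monic_X_pow_sub_C 5 (by norm_num), ?_⟩
  simp

instance QSqrtFive.instNumberField : NumberField QSqrtFive where
  to_charZero := inferInstance
  to_finiteDimensional := IntermediateField.adjoin.finiteDimensional sqrtFive_isIntegral

end PenroseVisible

end

/-!
Since `ℤ[ζ] = ℤ[τ] + ℤ[τ]ζ`, the points of `𝒫_ε` are the pairs `(a, b)` of golden integers of
nonzero residue whose conjugate lies in the window of their residue class. A pair with a common
factor that is not a unit is hidden: the factor has norm at least `4`, which leaves room for a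
multiple of the reduced pair by a unit. A coprime pair can only be hidden by its multiples by
elements of `ℤ[τ] ∩ (0, 1)`, and when `|ε| < 0.1` it is enough to consider `τ⁻¹` and `τ⁻²`, since
the other ones have a large conjugate. So visibility means coprimality together with a smaller
window.

The pairs in one residue class with conjugate in a given window are counted by embedding them as a
coset of a lattice in `ℂ × ℂ`: multiplying by a power of `τ` makes the rescaled lattice fine in
both factors, so that the count is asymptotic to a volume. Möbius inversion over the ideals of
`ℤ[τ]` prime to `√5`, with the tail controlled by counting in discs, extracts the coprime pairs
and multiplies the density by `(1 - 5⁻²)⁻¹ / ζ_K(2)`. The numerator comes from the areas of the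
smaller windows: the two pentagons removed from each of them are nested for the residues `±1`, and
for `±2` they are translates of one another by a vector that rescales to `±τε`.
-/

noncomputable section

namespace PenroseVisible

/-! ### The Dedekind zeta function as a sum over ideals -/

section DedekindZeta

open NumberField

variable (K : Type*) [Field K] [NumberField K]

theorem sum_card_absNorm_eq_isBigO :
    (fun n : ℕ ↦ ∑ k ∈ Finset.Icc 1 n, (Nat.card {I : Ideal (𝓞 K) // Ideal.absNorm I = k} : ℝ))
      =O[atTop] fun n : ℕ ↦ (n : ℝ) ^ (1 : ℝ) := by
  have hcard : (fun n : ℕ ↦ (Nat.card {I : Ideal (𝓞 K) // (Ideal.absNorm I : ℝ) ≤ (n : ℝ)} : ℝ))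
      =O[atTop] fun n : ℕ ↦ (n : ℝ) ^ (1 : ℝ) :=
    Asymptotics.isBigO_atTop_natCast_rpow_of_tendsto_div_rpow <| by
      simpa only [Real.rpow_one] using!
        (NumberField.Ideal.tendsto_norm_le_div_atTop K).comp tendsto_natCast_atTop_atTop
  refine Asymptotics.IsBigO.trans (Asymptotics.IsBigO.of_norm_le fun n ↦ ?_) hcard
  rw [← Nat.cast_sum, ← Finset.card_preimage_eq_sum_card_image_eq
    (fun k _ ↦ Ideal.finite_setOfPred_absNorm_eq k), Real.norm_natCast, Nat.cast_le]
  have hfinite : {I : Ideal (𝓞 K) | (Ideal.absNorm I : ℝ) ≤ (n : ℝ)}.Finite := by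
    simpa using Ideal.finite_setOfPred_absNorm_le (S := 𝓞 K) n
  refine Nat.card_mono hfinite fun I hI ↦ ?_
  simp only [Set.mem_preimage, SetLike.mem_coe, Finset.mem_Icc] at hI
  change (Ideal.absNorm I : ℝ) ≤ n
  exact_mod_cast hI.2

variable {K} {s : ℂ}

theorem tsum_absNorm_eq_cpow_neg (hs : s ≠ 0) (n : ℕ) :
    ∑' I : {I : Ideal (𝓞 K) // Ideal.absNorm I = n}, (Ideal.absNorm I.1 : ℂ) ^ (-s) =
      LSeries.term (fun n ↦ Nat.card {I : Ideal (𝓞 K) // Ideal.absNorm I = n}) s n := by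
  have hterm (I : {I : Ideal (𝓞 K) // Ideal.absNorm I = n}) :
      (Ideal.absNorm I.1 : ℂ) ^ (-s) = (n : ℂ) ^ (-s) := by rw [I.2]
  simp_rw [hterm, tsum_const, nsmul_eq_mul, LSeries.term_of_ne_zero' hs, Complex.cpow_neg,
    div_eq_mul_inv]

theorem summable_absNorm_cpow_neg (hs : 1 < s.re) :
    Summable fun I : Ideal (𝓞 K) ↦ (Ideal.absNorm I : ℂ) ^ (-s) := by
  have hs0 : s ≠ 0 := by rintro rfl; norm_num at hs
  have hnorm (n : ℕ) (I : {I : Ideal (𝓞 K) // Ideal.absNorm I = n}) :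
      ‖(Ideal.absNorm I.1 : ℂ) ^ (-s)‖ = ‖(n : ℂ) ^ (-s)‖ := by rw [I.2]
  rw [← (Equiv.sigmaFiberEquiv Ideal.absNorm).summable_iff, ← summable_norm_iff,
    summable_sigma_of_nonneg fun _ ↦ norm_nonneg _]
  refine ⟨fun n ↦ ?_, ?_⟩
  · have : Finite {I : Ideal (𝓞 K) // Ideal.absNorm I = n} :=
      (Ideal.finite_setOfPred_absNorm_eq n).to_subtype
    exact Summable.of_finite
  · refine (LSeriesSummable_of_sum_norm_bigO_and_nonneg (sum_card_absNorm_eq_isBigO K)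
      (fun n ↦ Nat.cast_nonneg _) zero_le_one hs).norm.congr fun n ↦ ?_
    calc ‖LSeries.term (fun n ↦ ((Nat.card {I : Ideal (𝓞 K) // Ideal.absNorm I = n} : ℝ) : ℂ)) s n‖
      _ = Nat.card {I : Ideal (𝓞 K) // Ideal.absNorm I = n} * ‖(n : ℂ) ^ (-s)‖ := by
        rw [LSeries.term_of_ne_zero' hs0, norm_div, Complex.ofReal_natCast, Complex.norm_natCast,
          Complex.cpow_neg, norm_inv, div_eq_mul_inv]
      _ = ∑' _ : {I : Ideal (𝓞 K) // Ideal.absNorm I = n}, ‖(n : ℂ) ^ (-s)‖ := by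
        rw [tsum_const, nsmul_eq_mul]
      _ = _ := tsum_congr fun I ↦ (hnorm n I).symm

theorem dedekindZeta_eq_tsum_absNorm_cpow_neg (hs : 1 < s.re) :
    dedekindZeta K s = ∑' I : Ideal (𝓞 K), (Ideal.absNorm I : ℂ) ^ (-s) := by
  have hs0 : s ≠ 0 := by rintro rfl; norm_num at hs
  have hsum := (Equiv.sigmaFiberEquiv Ideal.absNorm).summable_iff.2
    (summable_absNorm_cpow_neg (K := K) hs)
  calc dedekindZeta K s
    _ = ∑' n, ∑' I : {I : Ideal (𝓞 K) // Ideal.absNorm I = n}, (Ideal.absNorm I.1 : ℂ) ^ (-s) :=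
      tsum_congr fun n ↦ (tsum_absNorm_eq_cpow_neg hs0 n).symm
    _ = _ := hsum.tsum_sigma.symm
    _ = _ := (Equiv.sigmaFiberEquiv Ideal.absNorm).tsum_eq
      fun I : Ideal (𝓞 K) ↦ (Ideal.absNorm I : ℂ) ^ (-s)

end DedekindZeta

/-! ### Möbius inversion in unique factorization monoids -/

section Moebius

open UniqueFactorizationMonoid

variable {α : Type*} [CommMonoidWithZero α] [UniqueFactorizationMonoid α]

theorem abs_moebius_le_one (a : α) : |(moebius a : ℝ)| ≤ 1 := by
  by_cases h : Squarefree a <;> simp [h]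

theorem summable_moebius_mul {g : α → ℝ} (hg : Summable g) :
    Summable fun a ↦ (moebius a : ℝ) * g a :=
  .of_norm_bounded hg.norm fun a ↦ by
    rw [norm_mul, Real.norm_eq_abs]
    exact mul_le_of_le_one_left (norm_nonneg _) (abs_moebius_le_one a)

theorem moebius_prime_mul_of_dvd {p a : α} (hp : Prime p) (h : p ∣ a) : moebius (p * a) = 0 :=
  moebius_of_not_squarefree fun hs ↦ hp.not_isUnit (hs p (mul_dvd_mul_left p h))

theorem moebius_prime_mul_of_not_dvd {p a : α} (hp : Prime p) (h : ¬ p ∣ a) :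
    moebius (p * a) = -moebius a := by
  rw [((hp.irreducible.isRelPrime_iff_not_dvd).2 h).moebius_mul, hp.irreducible.moebius_eq,
    neg_one_mul]

theorem tsum_subtype_dvd {p : α} (hp : p ≠ 0) (g : α → ℝ) :
    ∑' a : {a | p ∣ a}, g a = ∑' a, g (p * a) := by
  have hrange : {a | p ∣ a} = Set.range (p * ·) :=
    Set.ext fun a ↦ exists_congr fun b ↦ eq_comm
  rw [hrange, tsum_range g (mul_right_injective₀ hp)]

/-- Terms divisible by `p` are paired with the others through `a ↦ p * a`, under which `μ` changes
sign or becomes zero. -/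
theorem tsum_moebius_mul_eq_tsum_not_dvd {p : α} (hp : Prime p) {g : α → ℝ} (hg : Summable g) :
    ∑' a, (moebius a : ℝ) * g a =
      ∑' a : ({a | p ∣ a}ᶜ : Set α), (moebius a.1 : ℝ) * (g a - g (p * a)) := by
  have hg' : Summable fun a ↦ g (p * a) := hg.comp_injective (mul_right_injective₀ hp.ne_zero)
  have hdvd : ∑' a : {a | p ∣ a}, (moebius a.1 : ℝ) * g a =
      ∑' a : ({a | p ∣ a}ᶜ : Set α), -((moebius a.1 : ℝ) * g (p * a)) := calc
    _ = ∑' a, (moebius (p * a) : ℝ) * g (p * a) :=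
      tsum_subtype_dvd hp.ne_zero fun a ↦ (moebius a : ℝ) * g a
    _ = ∑' a : ({a | p ∣ a}ᶜ : Set α), (moebius (p * a.1) : ℝ) * g (p * a) := by
      refine (tsum_subtype_eq_of_support_subset (s := {a | p ∣ a}ᶜ)
        (f := fun a ↦ (moebius (p * a) : ℝ) * g (p * a)) fun a ha h ↦ ha ?_).symm
      beta_reduce
      rw [moebius_prime_mul_of_dvd hp h, Int.cast_zero, zero_mul]
    _ = _ := tsum_congr fun a ↦ by
      rw [moebius_prime_mul_of_not_dvd hp a.2, Int.cast_neg, neg_mul]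
  rw [← (summable_moebius_mul hg).tsum_subtype_add_tsum_subtype_compl {a | p ∣ a}, hdvd, tsum_neg,
    ← sub_eq_neg_add]
  refine (((summable_moebius_mul hg).subtype _).tsum_sub
    ((summable_moebius_mul hg').subtype _)).symm.trans (tsum_congr fun a ↦ ?_)
  exact (mul_sub ..).symm

variable [Unique αˣ]

theorem finite_setOf_dvd {b : α} (hb : b ≠ 0) : {a : α | a ∣ b}.Finite :=
  have : Finite {a : α | a ∣ b} := (fintypeSubtypeDvd b hb).finite
  Set.toFinite _

theorem tsum_moebius_dvd [DecidableEq α] {b : α} (hb : b ≠ 0) :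
    ∑' a : {a | a ∣ b}, (moebius a.1 : ℝ) = if b = 1 then 1 else 0 := by
  split_ifs with hb1
  · have hdvd : {a | a ∣ b} = {1} := by
      simp only [hb1, ← isUnit_iff_dvd_one, isUnit_iff_eq_one, Set.ofPred_eq_eq_singleton]
    rw [hdvd, tsum_singleton 1 fun a : α ↦ (moebius a : ℝ), moebius_one, Int.cast_one]
  obtain ⟨p, hp, hpb⟩ := WfDvdMonoid.exists_irreducible_factor (mt isUnit_iff_eq_one.1 hb1) hb
  have hfin : Summable ({a | a ∣ b}.indicator fun _ ↦ (1 : ℝ)) :=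
    summable_of_hasFiniteSupport ((finite_setOf_dvd hb).subset Set.support_indicator_subset)
  have hmul (a : α) : {a | a ∣ b}.indicator (fun a ↦ (moebius a : ℝ)) a =
      moebius a * {a | a ∣ b}.indicator (fun _ ↦ (1 : ℝ)) a := by
    by_cases h : a ∣ b <;> simp [h]
  rw [tsum_subtype {a | a ∣ b} fun a ↦ (moebius a : ℝ), tsum_congr hmul,
    tsum_moebius_mul_eq_tsum_not_dvd hp.prime hfin]
  refine (tsum_congr fun a ↦ ?_).trans tsum_zero
  have hiff : p * a.1 ∣ b ↔ a.1 ∣ b :=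
    ⟨(dvd_mul_left _ p).trans, ((hp.isRelPrime_iff_not_dvd).2 a.2).mul_dvd hpb⟩
  by_cases h : a.1 ∣ b <;> simp [h, hiff]

theorem ncard_sep_eq_one_eq_tsum {X : Type*} {S : Set X} (hS : S.Finite) {g : X → α}
    (hg : ∀ x ∈ S, g x ≠ 0) :
    ({x ∈ S | g x = 1}.ncard : ℝ) = ∑' a, (moebius a : ℝ) * {x ∈ S | a ∣ g x}.ncard := by
  classical
  have hcard (P : X → Prop) [DecidablePred P] :
      ({x ∈ S | P x}.ncard : ℝ) = ∑ x ∈ hS.toFinset, if P x then 1 else 0 := by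
    rw [Set.ncard_eq_toFinset_card _ (hS.subset (Set.sep_subset S P)), Finset.card_eq_sum_ones,
      ← Finset.sum_filter, Nat.cast_sum]
    refine Finset.sum_congr (by ext; simp) fun _ _ ↦ Nat.cast_one
  have hind (x : X) : (fun a ↦ (moebius a : ℝ) * if a ∣ g x then 1 else 0) =
      {a | a ∣ g x}.indicator fun a ↦ (moebius a : ℝ) := by
    ext a
    by_cases h : a ∣ g x <;> simp [h]
  have hsum : ∀ x ∈ hS.toFinset,
      Summable fun a ↦ (moebius a : ℝ) * if a ∣ g x then 1 else 0 := fun x hx ↦ by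
    rw [hind]
    exact summable_of_hasFiniteSupport ((finite_setOf_dvd (hg x (hS.mem_toFinset.1 hx))).subset
      Set.support_indicator_subset)
  simp_rw [hcard, Finset.mul_sum]
  rw [Summable.tsum_finsetSum hsum]
  refine Finset.sum_congr rfl fun x hx ↦ ?_
  rw [hind, ← tsum_subtype, tsum_moebius_dvd (hg x (hS.mem_toFinset.1 hx))]

variable {f : α →*₀ ℝ}

theorem tsum_fiber_mul_moebius_mul [DecidableEq α] (c : α) :
    ∑' x : {x : α × α // x.1 * x.2 = c}, (moebius x.1.1 : ℝ) * f x.1.1 * f x.1.2 =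
      if c = 1 then 1 else 0 := by
  have hf (x : {x : α × α // x.1 * x.2 = c}) :
      (moebius x.1.1 : ℝ) * f x.1.1 * f x.1.2 = moebius x.1.1 * f c := by
    rw [mul_assoc, ← map_mul, x.2]
  rw [tsum_congr hf, tsum_mul_right]
  obtain rfl | hc := eq_or_ne c 0
  · have : (0 : α) ≠ 1 := fun h ↦ by simpa using congrArg f h
    rw [map_zero, mul_zero, if_neg this]
  have hinj : Function.Injective fun x : {x : α × α // x.1 * x.2 = c} ↦ x.1.1 := by
    rintro ⟨⟨a, b⟩, rfl⟩ ⟨⟨a', b'⟩, h⟩ (rfl : a = a')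
    simp only [Subtype.mk.injEq, Prod.mk.injEq, true_and]
    exact (mul_left_cancel₀ (left_ne_zero_of_mul hc) h).symm
  have hrange : (Set.range fun x : {x : α × α // x.1 * x.2 = c} ↦ x.1.1) = {a | a ∣ c} :=
    Set.ext fun a ↦ ⟨fun ⟨x, hx⟩ ↦ ⟨x.1.2, hx ▸ x.2.symm⟩, fun ⟨b, hb⟩ ↦ ⟨⟨(a, b), hb.symm⟩, rfl⟩⟩
  rw [← tsum_range (fun a ↦ (moebius a : ℝ)) hinj, hrange, tsum_moebius_dvd hc]
  split_ifs with h
  · rw [h, map_one, mul_one]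
  · rw [zero_mul]

theorem tsum_moebius_mul_mul_tsum (hf : Summable f) :
    (∑' a, (moebius a : ℝ) * f a) * ∑' a, f a = 1 := by
  classical
  have hsum : Summable fun x : α × α ↦ (moebius x.1 : ℝ) * f x.1 * f x.2 :=
    summable_mul_of_summable_norm (summable_moebius_mul hf).norm hf.norm
  let e := Equiv.sigmaFiberEquiv fun x : α × α ↦ x.1 * x.2
  calc (∑' a, (moebius a : ℝ) * f a) * ∑' a, f a
    _ = ∑' x : α × α, (moebius x.1 : ℝ) * f x.1 * f x.2 :=
      tsum_mul_tsum_of_summable_norm (summable_moebius_mul hf).norm hf.norm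
    _ = ∑' x, (moebius (e x).1 : ℝ) * f (e x).1 * f (e x).2 := (e.tsum_eq _).symm
    _ = ∑' c, ∑' x : {x : α × α // x.1 * x.2 = c}, (moebius x.1.1 : ℝ) * f x.1.1 * f x.1.2 :=
      (e.summable_iff.2 hsum).tsum_sigma
    _ = ∑' c : α, if c = 1 then 1 else 0 := tsum_congr tsum_fiber_mul_moebius_mul
    _ = 1 := tsum_ite_eq 1 _

theorem one_sub_mul_tsum_moebius_mul_tsum {p : α} (hp : Prime p) (hf : Summable f) :
    (1 - f p) * (∑' a : ({a | p ∣ a}ᶜ : Set α), (moebius a.1 : ℝ) * f a) * ∑' a, f a = 1 := by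
  have hmul (a : ({a | p ∣ a}ᶜ : Set α)) : (moebius a.1 : ℝ) * (f a - f (p * a)) =
      (1 - f p) * ((moebius a.1 : ℝ) * f a) := by rw [map_mul]; ring
  refine .trans ?_ (tsum_moebius_mul_mul_tsum hf)
  rw [tsum_moebius_mul_eq_tsum_not_dvd hp hf, tsum_congr hmul, tsum_mul_left]

end Moebius

/-! ### Counting lattice points -/

section LatticeCount

theorem inter_frontier_nonempty {X : Type*} [TopologicalSpace X] {s E : Set X}
    (hs : IsPreconnected s) (hsE : (s ∩ E).Nonempty) (hsEc : (s \ E).Nonempty) :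
    (s ∩ frontier E).Nonempty := by
  by_contra! hempty
  have hE : s ∩ E ⊆ interior E := fun x ⟨hx, hxE⟩ ↦ by
    by_contra hint
    exact hempty.le ⟨hx, subset_closure hxE, hint⟩
  have hEc : s \ E ⊆ (closure E)ᶜ := fun x ⟨hx, hxE⟩ hcl ↦
    hempty.le ⟨hx, hcl, mt (interior_subset ·) hxE⟩
  obtain ⟨x, -, hx, hx'⟩ := hs _ _ isOpen_interior isClosed_closure.isOpen_compl
    (fun x hx ↦ (em (x ∈ E)).imp (fun h ↦ hE ⟨hx, h⟩) fun h ↦ hEc ⟨hx, h⟩)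
    (hsE.imp fun x hx ↦ ⟨hx.1, hE hx⟩) (hsEc.imp fun x hx ↦ ⟨hx.1, hEc hx⟩)
  exact hx' (interior_subset_closure hx)

variable {V : Type*} [NormedAddCommGroup V] [NormedSpace ℝ V]

theorem exists_mem_frontier_dist_le {E : Set V} {x y : V} (hx : x ∈ E) (hy : y ∉ E) :
    ∃ z ∈ frontier E, dist x z ≤ dist x y := by
  have hne : (segment ℝ x y ∩ frontier E).Nonempty :=
    inter_frontier_nonempty (convex_segment x y).isPreconnected
      ⟨x, left_mem_segment ℝ x y, hx⟩ ⟨y, right_mem_segment ℝ x y, hy⟩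
  obtain ⟨z, hz, hzE⟩ := hne
  exact ⟨z, hzE, (le_add_of_nonneg_right dist_nonneg).trans_eq (dist_add_dist_of_mem_segment hz)⟩

theorem mem_or_mem_cthickening_frontier {E : Set V} {x y : V} {δ : ℝ} (hx : x ∈ E)
    (hxy : dist x y ≤ δ) : y ∈ E ∨ x ∈ Metric.cthickening δ (frontier E) := by
  refine or_iff_not_imp_left.2 fun hy ↦ ?_
  obtain ⟨z, hz, hxz⟩ := exists_mem_frontier_dist_le hx hy
  exact Metric.mem_cthickening_of_dist_le x z δ _ hz (hxz.trans hxy)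

theorem mem_or_mem_cthickening_frontier' {E : Set V} {x y : V} {δ : ℝ} (hy : y ∈ E)
    (hxy : dist x y ≤ δ) : x ∈ E ∨ x ∈ Metric.cthickening δ (frontier E) := by
  refine or_iff_not_imp_left.2 fun hx ↦ ?_
  obtain ⟨z, hz, hxz⟩ := exists_mem_frontier_dist_le (E := Eᶜ) hx (not_not.2 hy)
  rw [frontier_compl] at hz
  exact Metric.mem_cthickening_of_dist_le x z δ _ hz (hxz.trans hxy)

variable {ι : Type*} [Fintype ι] (b : Module.Basis ι ℝ V)

/-- The point with integer coordinates `v` in the lattice spanned by `b`. -/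
def latticePoint (v : ι → ℤ) : V := ∑ i, (v i : ℝ) • b i

theorem sub_latticePoint_mem_fundamentalDomain_iff {x : V} {v : ι → ℤ} :
    x - latticePoint b v ∈ ZSpan.fundamentalDomain b ↔ v = fun i ↦ ⌊b.repr x i⌋ := by
  rw [ZSpan.mem_fundamentalDomain, funext_iff]
  refine forall_congr' fun i ↦ ?_
  rw [latticePoint, map_sub, Finsupp.sub_apply, b.repr_sum_self, eq_comm, Int.floor_eq_iff,
    Set.mem_Ico, sub_nonneg, sub_lt_iff_lt_add']

theorem norm_le_of_mem_fundamentalDomain {x : V} (hx : x ∈ ZSpan.fundamentalDomain b) :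
    ‖x‖ ≤ ∑ i, ‖b i‖ := by
  rw [← ZSpan.fract_eq_self.2 hx]
  exact ZSpan.norm_fract_le b x

variable [MeasurableSpace V] [BorelSpace V] (μ : Measure V)

theorem measure_iUnion_vadd_fundamentalDomain [μ.IsAddLeftInvariant]
    (w : V) (S : Set (ι → ℤ)) :
    μ (⋃ v ∈ S, (latticePoint b v + w) +ᵥ ZSpan.fundamentalDomain b) =
      S.encard * μ (ZSpan.fundamentalDomain b) := by
  have hdisj : S.PairwiseDisjoint fun v ↦ (latticePoint b v + w) +ᵥ ZSpan.fundamentalDomain b := by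
    refine fun v _ v' _ hne ↦ Set.disjoint_left.2 fun x hx hx' ↦ hne ?_
    rw [Set.mem_vadd_set_iff_neg_vadd_mem, vadd_eq_add, neg_add_eq_sub, sub_add_eq_sub_sub_swap,
      sub_latticePoint_mem_fundamentalDomain_iff] at hx hx'
    exact hx.trans hx'.symm
  rw [measure_biUnion S.to_countable hdisj fun v _ ↦
    (ZSpan.fundamentalDomain_measurableSet b).const_vadd _, ← ENNReal.tsum_set_const]
  exact tsum_congr fun v ↦ measure_vadd μ _ _

theorem encard_mul_measure_fundamentalDomain_le [μ.IsAddLeftInvariant]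
    (w : V) (E : Set V) :
    {v : ι → ℤ | latticePoint b v + w ∈ E}.encard * μ (ZSpan.fundamentalDomain b) ≤
      μ E + μ (Metric.cthickening (∑ i, ‖b i‖) (frontier E)) := by
  rw [← measure_iUnion_vadd_fundamentalDomain b μ w]
  refine (measure_mono fun x hx ↦ ?_).trans (measure_union_le _ _)
  obtain ⟨v, hv, y, hy, rfl⟩ := Set.mem_iUnion₂.1 hx
  refine mem_or_mem_cthickening_frontier' hv ?_
  simpa only [vadd_eq_add, dist_self_add_left] using norm_le_of_mem_fundamentalDomain b hy

theorem measure_le_encard_mul_measure_fundamentalDomain_add [μ.IsAddLeftInvariant]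
    (w : V) (E : Set V) :
    μ E ≤ {v : ι → ℤ | latticePoint b v + w ∈ E}.encard * μ (ZSpan.fundamentalDomain b) +
      μ (Metric.cthickening (∑ i, ‖b i‖) (frontier E)) := by
  rw [← measure_iUnion_vadd_fundamentalDomain b μ w]
  refine (measure_mono fun x hx ↦ ?_).trans (measure_union_le _ _)
  have hmem := (sub_latticePoint_mem_fundamentalDomain_iff b (x := x - w)).2 rfl
  set v : ι → ℤ := fun i ↦ ⌊b.repr (x - w) i⌋
  rw [← sub_add_eq_sub_sub_swap] at hmem
  refine (mem_or_mem_cthickening_frontier hx (y := latticePoint b v + w) ?_).imp_left fun hv ↦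
    Set.mem_iUnion₂.2 ⟨v, hv, _, hmem, add_sub_cancel ..⟩
  rw [dist_eq_norm]
  exact norm_le_of_mem_fundamentalDomain b hmem

variable {μ} {α : Type*} {l : Filter α} {E : Set V}

theorem tendsto_measure_cthickening_frontier [FiniteDimensional ℝ V]
    [IsFiniteMeasureOnCompacts μ] (hE : Bornology.IsBounded E) (hfr : μ (frontier E) = 0) :
    Tendsto (fun δ ↦ μ (Metric.cthickening δ (frontier E))) (𝓝 0) (𝓝 0) := by
  have hbdd : Bornology.IsBounded (frontier E) := hE.closure.subset frontier_subset_closure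
  have hlim := tendsto_measure_cthickening_of_isClosed (μ := μ) (s := frontier E)
    ⟨1, one_pos, hbdd.cthickening.measure_lt_top.ne⟩ isClosed_frontier
  rwa [hfr] at hlim

theorem tendsto_ncard_latticePoint_mul [FiniteDimensional ℝ V] [μ.IsAddHaarMeasure]
    (hE : Bornology.IsBounded E) (hfr : μ (frontier E) = 0) {b : α → Module.Basis ι ℝ V}
    (hb : ∀ i, Tendsto (fun j ↦ b j i) l (𝓝 0)) (w : α → V) :
    Tendsto (fun j ↦ ({v : ι → ℤ | latticePoint (b j) v + w j ∈ E}.ncard : ℝ) *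
      μ.real (ZSpan.fundamentalDomain (b j))) l (𝓝 (μ.real E)) := by
  have hδ : Tendsto (fun j ↦ ∑ i, ‖b j i‖) l (𝓝 0) := by
    simpa using tendsto_finsetSum Finset.univ fun i _ ↦ (hb i).norm
  have hε := (tendsto_measure_cthickening_frontier hE hfr).comp hδ
  have hEt : μ E ≠ ⊤ := hE.measure_lt_top.ne
  have hlim : Tendsto (fun j ↦ {v : ι → ℤ | latticePoint (b j) v + w j ∈ E}.encard *
      μ (ZSpan.fundamentalDomain (b j))) l (𝓝 (μ E)) := by
    refine tendsto_of_tendsto_of_tendsto_of_le_of_le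
      (by simpa using ENNReal.Tendsto.sub (tendsto_const_nhds (x := μ E)) hε (.inl hEt))
      (by simpa using (tendsto_const_nhds (x := μ E)).add hε)
      (fun j ↦ tsub_le_iff_right.2 ?_) fun j ↦ ?_
    · exact measure_le_encard_mul_measure_fundamentalDomain_add (b j) μ (w j) E
    · exact encard_mul_measure_fundamentalDomain_le (b j) μ (w j) E
  refine ((ENNReal.tendsto_toReal hEt).comp hlim).congr fun j ↦ ?_
  rw [Function.comp_apply, ENNReal.toReal_mul, Set.ncard_def, measureReal_def]
  congr 1
  induction {v : ι → ℤ | latticePoint (b j) v + w j ∈ E}.encard using ENat.recTopCoe <;> simp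

end LatticeCount

section LatticeBound

variable {V : Type*} [NormedAddCommGroup V] [NormedSpace ℝ V] {ι : Type*} [Fintype ι]

theorem exists_norm_le_mul_norm_latticePoint (b : Module.Basis ι ℝ V) :
    ∃ C : ℝ, 0 < C ∧ ∀ v : ι → ℤ, ‖v‖ ≤ C * ‖latticePoint b v‖ := by
  have : FiniteDimensional ℝ V := b.finiteDimensional_of_finite
  obtain ⟨C, hC, hle⟩ := (b.equivFunL : V →L[ℝ] ι → ℝ).bound
  refine ⟨C, hC, fun v ↦ (pi_norm_le_iff_of_nonneg (by positivity)).2 fun i ↦ ?_⟩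
  have hcoord : b.equivFunL (latticePoint b v) i = v i :=
    congrFun (b.repr_sum_self fun i ↦ (v i : ℝ)) i
  rw [← Int.norm_cast_real, ← hcoord]
  exact (norm_le_pi_norm _ i).trans (hle _)

theorem finite_ncard_intVector_le {ρ : ℝ} (hρ : 0 ≤ ρ) :
    {v : ι → ℤ | v ≠ 0 ∧ ‖v‖ ≤ ρ}.Finite ∧
      ({v : ι → ℤ | v ≠ 0 ∧ ‖v‖ ≤ ρ}.ncard : ℝ) ≤ (3 * ρ) ^ Fintype.card ι := by
  classical
  let B : Finset (ι → ℤ) := Fintype.piFinset fun _ ↦ Finset.Icc (-(⌊ρ⌋₊ : ℤ)) ⌊ρ⌋₊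
  have hsub : {v : ι → ℤ | v ≠ 0 ∧ ‖v‖ ≤ ρ} ⊆ B := fun v ⟨_, hv⟩ ↦ by
    refine Fintype.mem_piFinset.2 fun i ↦ ?_
    rw [Finset.mem_Icc, ← abs_le, Int.abs_eq_natAbs, Nat.cast_le]
    refine Nat.le_floor ?_
    rw [Nat.cast_natAbs, Int.cast_abs, ← Real.norm_eq_abs, Int.norm_cast_real]
    exact (norm_le_pi_norm v i).trans hv
  refine ⟨B.finite_toSet.subset hsub, ?_⟩
  rcases lt_or_ge ρ 1 with hρ1 | hρ1
  · have hempty : {v : ι → ℤ | v ≠ 0 ∧ ‖v‖ ≤ ρ} = ∅ := by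
      refine Set.eq_empty_of_forall_notMem fun v hv ↦ hv.1 (funext fun i ↦ ?_)
      simpa [B, Nat.floor_eq_zero.2 hρ1] using Fintype.mem_piFinset.1 (hsub hv) i
    rw [hempty, Set.ncard_empty, Nat.cast_zero]
    positivity
  have hcard : B.card = (2 * ⌊ρ⌋₊ + 1) ^ Fintype.card ι := by
    rw [Fintype.card_piFinset, Finset.prod_const, Finset.card_univ, Int.card_Icc]
    congr 1
    lia
  calc ({v : ι → ℤ | v ≠ 0 ∧ ‖v‖ ≤ ρ}.ncard : ℝ)
    _ ≤ B.card :=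
      mod_cast (Set.ncard_le_ncard hsub B.finite_toSet).trans_eq (Set.ncard_coe_finset B)
    _ = (2 * ⌊ρ⌋₊ + 1) ^ Fintype.card ι := mod_cast hcard
    _ ≤ (3 * ρ) ^ Fintype.card ι := by
      gcongr
      linarith [Nat.floor_le hρ]

theorem exists_finite_ncard_latticePoint_le (b : Module.Basis ι ℝ V) :
    ∃ C : ℝ, 0 < C ∧ ∀ ρ, 0 ≤ ρ → {v : ι → ℤ | v ≠ 0 ∧ ‖latticePoint b v‖ ≤ ρ}.Finite ∧
      ({v : ι → ℤ | v ≠ 0 ∧ ‖latticePoint b v‖ ≤ ρ}.ncard : ℝ) ≤ (C * ρ) ^ Fintype.card ι := by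
  obtain ⟨C, hC, hle⟩ := exists_norm_le_mul_norm_latticePoint b
  refine ⟨3 * C, by positivity, fun ρ hρ ↦ ?_⟩
  have hsub : {v : ι → ℤ | v ≠ 0 ∧ ‖latticePoint b v‖ ≤ ρ} ⊆ {v | v ≠ 0 ∧ ‖v‖ ≤ C * ρ} :=
    fun v hv ↦ ⟨hv.1, (hle v).trans (mul_le_mul_of_nonneg_left hv.2 hC.le)⟩
  obtain ⟨hfin, hcard⟩ := finite_ncard_intVector_le (ι := ι) (mul_nonneg hC.le hρ)
  refine ⟨hfin.subset hsub, le_trans ?_ (hcard.trans_eq (by rw [mul_assoc]))⟩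
  exact_mod_cast Set.ncard_le_ncard hsub hfin

end LatticeBound

/-! ### Regular polygons -/

section RegularPolygon

open scoped InnerProductSpace

theorem exists_pow_eq_one_le_inner {n : ℕ} (hn : n ≠ 0) (a : ℂ) :
    ∃ w : ℂ, w ^ n = 1 ∧ ‖a‖ * Real.cos (Real.pi / n) ≤ ⟪a, w⟫_ℝ := by
  set k := round (n * a.arg / (2 * Real.pi))
  set θ := 2 * Real.pi * k / n
  refine ⟨Complex.exp (θ * Complex.I), ?_, ?_⟩
  · rw [← Complex.exp_nat_mul, Complex.exp_eq_one_iff]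
    exact ⟨k, by simp only [θ]; push_cast; field_simp⟩
  have hinner : ⟪a, Complex.exp (θ * Complex.I)⟫_ℝ = ‖a‖ * Real.cos (a.arg - θ) := by
    have hre : ⟪a, Complex.exp (θ * Complex.I)⟫_ℝ = Real.cos θ * a.re + Real.sin θ * a.im := by
      simp [Complex.inner, Complex.exp_re, Complex.exp_im]
    rw [hre, Real.cos_sub]
    linear_combination (-Real.cos θ) * Complex.norm_mul_cos_arg a -
      Real.sin θ * Complex.norm_mul_sin_arg a
  have hdist : |a.arg - θ| ≤ Real.pi / n := by
    have hround := abs_sub_round (n * a.arg / (2 * Real.pi))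
    have heq : a.arg - θ = 2 * Real.pi / n * (n * a.arg / (2 * Real.pi) - k) := by
      simp only [θ]; field_simp
    rw [heq, abs_mul, abs_of_pos (by positivity)]
    calc 2 * Real.pi / n * |n * a.arg / (2 * Real.pi) - k|
      _ ≤ 2 * Real.pi / n * (1 / 2) := by gcongr
      _ = Real.pi / n := by ring
  rw [hinner, ← Real.cos_abs (a.arg - θ)]
  gcongr
  exact Real.cos_le_cos_of_nonneg_of_le_pi (abs_nonneg _)
    (div_le_self Real.pi_pos.le (mod_cast hn.bot_lt)) hdist

theorem ball_subset_convexHull_setOf_pow_eq_one {n : ℕ} (hn : n ≠ 0) :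
    Metric.ball 0 (Real.cos (Real.pi / n)) ⊆ convexHull ℝ {z : ℂ | z ^ n = 1} := by
  intro z hz
  by_contra hzc
  have hclosed : IsClosed (convexHull ℝ {z : ℂ | z ^ n = 1}) := by
    refine Set.Finite.isClosed_convexHull ℝ ?_
    convert (nthRootsFinset n (1 : ℂ)).finite_toSet using 1
    ext w
    simp [mem_nthRootsFinset hn.bot_lt]
  obtain ⟨f, u, hf, hu⟩ := geometric_hahn_banach_closed_point (convex_convexHull ℝ _) hclosed hzc
  obtain ⟨a, rfl⟩ := (InnerProductSpace.toDual ℝ ℂ).surjective f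
  obtain ⟨w, hw, hle⟩ := exists_pow_eq_one_le_inner hn a
  refine lt_irrefl (⟪a, z⟫_ℝ) ?_
  calc ⟪a, z⟫_ℝ
    _ ≤ ‖a‖ * ‖z‖ := real_inner_le_norm a z
    _ ≤ ‖a‖ * Real.cos (Real.pi / n) := by gcongr; exact (mem_ball_zero_iff.1 hz).le
    _ ≤ ⟪a, w⟫_ℝ := hle
    _ < ⟪a, z⟫_ℝ := (hf w (subset_convexHull ℝ _ hw)).trans hu

end RegularPolygon

open scoped goldenRatio

/-! ### The ring of golden integers -/

/-- The ring `ℤ[τ]`, presented as `ℤ[ω]` with `ω² = 1 + ω`. -/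
abbrev GoldenInt : Type := QuadraticAlgebra ℤ 1 1

namespace GoldenInt

/-- The real embedding `ω ↦ τ` of `ℤ[τ]`. -/
def toReal : GoldenInt →ₐ[ℤ] ℝ :=
  QuadraticAlgebra.lift ⟨φ, by rw [one_smul, one_smul, ← sq, Real.goldenRatio_sq, add_comm]⟩

/-- The real embedding `ω ↦ 1 - τ` of `ℤ[τ]`, through which `σ` acts on `ℤ[τ] ⊆ ℤ[ζ]`. -/
def conj : GoldenInt →ₐ[ℤ] ℝ :=
  QuadraticAlgebra.lift ⟨ψ, by rw [one_smul, one_smul, ← sq, Real.goldenConj_sq, add_comm]⟩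

/-- Reduction of `ℤ[τ]` modulo the prime `√5`; as `ζ ↦ 1`, it maps `τ = -ζ² - ζ³` to `-2 = 3`. -/
def mod5 : GoldenInt →ₐ[ℤ] ZMod 5 :=
  QuadraticAlgebra.lift ⟨3, by decide⟩

theorem toReal_apply (a : GoldenInt) : toReal a = a.re + a.im * φ := by
  simp [toReal]

theorem conj_apply (a : GoldenInt) : conj a = a.re + a.im * ψ := by
  simp [conj]

theorem mod5_apply (a : GoldenInt) : mod5 a = a.re + a.im * 3 := by
  simp [mod5]

theorem toReal_mul_conj (a : GoldenInt) : toReal a * conj a = a.norm := by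
  rw [toReal_apply, conj_apply, QuadraticAlgebra.norm_def]
  push_cast
  linear_combination (a.im ^ 2 : ℝ) * Real.goldenRatio_mul_goldenConj +
    (a.re * a.im : ℝ) * Real.goldenRatio_add_goldenConj

theorem eq_zero_of_add_mul_eq_zero {a : GoldenInt} {x : ℝ} (hx : Irrational x)
    (h : a.re + a.im * x = 0) : a = 0 := by
  by_cases him : a.im = 0
  · refine QuadraticAlgebra.ext ?_ him
    simpa [him] using h
  · exact absurd h ((hx.intCast_mul him).intCast_add a.re).ne_zero

theorem toReal_injective : Function.Injective toReal :=
  (injective_iff_map_eq_zero toReal).2 fun a ha ↦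
    eq_zero_of_add_mul_eq_zero Real.goldenRatio_irrational (toReal_apply a ▸ ha)

theorem conj_injective : Function.Injective conj :=
  (injective_iff_map_eq_zero conj).2 fun a ha ↦
    eq_zero_of_add_mul_eq_zero Real.goldenConj_irrational (conj_apply a ▸ ha)

theorem norm_eq_zero {a : GoldenInt} : a.norm = 0 ↔ a = 0 := by
  rw [← Int.cast_inj (α := ℝ), ← toReal_mul_conj, Int.cast_zero, mul_eq_zero,
    map_eq_zero_iff _ toReal_injective, map_eq_zero_iff _ conj_injective, or_self]

/-- The quotient `y / x` with both coordinates rounded to nearest integers. -/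
def roundDiv (y x : GoldenInt) : GoldenInt :=
  ⟨round ((y * star x).re / x.norm : ℚ), round ((y * star x).im / x.norm : ℚ)⟩

theorem two_mul_abs_sub_mul_round_le (a : ℤ) {n : ℤ} (hn : n ≠ 0) :
    2 * |a - n * round (a / n : ℚ)| ≤ |n| := by
  have hn' : (n : ℚ) ≠ 0 := mod_cast hn
  have heq : (a : ℚ) - n * round (a / n : ℚ) = n * (a / n - round (a / n : ℚ)) := by
    field_simp
  have hle : 2 * |(a : ℚ) - n * round (a / n : ℚ)| ≤ |(n : ℚ)| := by
    rw [heq, abs_mul]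
    linarith [mul_le_mul_of_nonneg_left (abs_sub_round (a / n : ℚ)) (abs_nonneg (n : ℚ))]
  exact_mod_cast hle

theorem abs_sq_add_mul_sub_sq_lt {s t n : ℤ} (hn : n ≠ 0) (hs : 2 * |s| ≤ |n|)
    (ht : 2 * |t| ≤ |n|) : |s ^ 2 + s * t - t ^ 2| < n ^ 2 := by
  have hpos : 0 < |n| := abs_pos.2 hn
  have hs2 : 4 * s ^ 2 ≤ n ^ 2 := by
    rw [← sq_abs s, ← sq_abs n]
    nlinarith [abs_nonneg s]
  have ht2 : 4 * t ^ 2 ≤ n ^ 2 := by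
    rw [← sq_abs t, ← sq_abs n]
    nlinarith [abs_nonneg t]
  have hn2 : 0 < n ^ 2 := by positivity
  rw [abs_lt]
  constructor <;> nlinarith [sq_nonneg (s + t), sq_nonneg (s - t), sq_nonneg s, sq_nonneg t]

/-- `(y - x q) x*` has both coordinates at most `|N x| / 2`, hence norm less than `(N x)²`. -/
theorem abs_norm_sub_mul_roundDiv_lt (y : GoldenInt) {x : GoldenInt} (hx : x ≠ 0) :
    |(y - x * roundDiv y x).norm| < |x.norm| := by
  have hN : x.norm ≠ 0 := mt norm_eq_zero.1 hx
  have hkey : (y - x * roundDiv y x).norm * x.norm =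
      ((y * star x).re - x.norm * (roundDiv y x).re) ^ 2 +
        ((y * star x).re - x.norm * (roundDiv y x).re) *
          ((y * star x).im - x.norm * (roundDiv y x).im) -
        ((y * star x).im - x.norm * (roundDiv y x).im) ^ 2 := by
    simp only [QuadraticAlgebra.norm_def, QuadraticAlgebra.re_mul, QuadraticAlgebra.im_mul,
      QuadraticAlgebra.re_sub, QuadraticAlgebra.im_sub, QuadraticAlgebra.re_star,
      QuadraticAlgebra.im_star]
    ring
  refine lt_of_mul_lt_mul_right ?_ (abs_nonneg x.norm)
  rw [← abs_mul, hkey, ← abs_mul, ← sq, abs_of_nonneg (sq_nonneg x.norm)]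
  exact abs_sq_add_mul_sub_sq_lt hN (two_mul_abs_sub_mul_round_le _ hN)
    (two_mul_abs_sub_mul_round_le _ hN)

instance : EuclideanDomain GoldenInt where
  quotient := roundDiv
  remainder y x := y - x * roundDiv y x
  quotient_zero y := by ext <;> simp [roundDiv]
  quotient_mul_add_remainder_eq y x := add_sub_cancel ..
  r y x := y.norm.natAbs < x.norm.natAbs
  r_wellFounded := (measure fun x : GoldenInt ↦ x.norm.natAbs).wf
  remainder_lt y x hx := by
    have h := abs_norm_sub_mul_roundDiv_lt y hx
    rwa [Int.abs_eq_natAbs, Int.abs_eq_natAbs, Int.ofNat_lt] at h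
  mul_left_not_lt x y hy := by
    rw [not_lt, map_mul, Int.natAbs_mul]
    exact Nat.le_mul_of_pos_right _ (Int.natAbs_pos.2 (mt norm_eq_zero.1 hy))

theorem absNorm_span_singleton (d : GoldenInt) :
    (Ideal.absNorm (Ideal.span {d}) : ℝ) = |toReal d * conj d| := by
  have hnorm : Algebra.norm ℤ d = d.norm := by
    rw [Algebra.norm_apply, ← QuadraticAlgebra.det_toLinearMap_eq_norm]
    rfl
  rw [Ideal.absNorm_span_singleton, toReal_mul_conj, hnorm, Nat.cast_natAbs, Int.cast_abs]

/-- The fundamental unit `τ`. -/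
def tauUnit : GoldenIntˣ where
  val := ⟨0, 1⟩
  inv := ⟨-1, 1⟩
  val_inv := by ext <;> simp [QuadraticAlgebra.re_one, QuadraticAlgebra.im_one]
  inv_val := by ext <;> simp [QuadraticAlgebra.re_one, QuadraticAlgebra.im_one]

theorem toReal_tauUnit_zpow (n : ℤ) : toReal ↑(tauUnit ^ n) = φ ^ n := by
  have h : (Units.map (toReal : GoldenInt →* ℝ) tauUnit : ℝ) = φ := by
    simp [tauUnit, toReal_apply]
  rw [← h, ← Units.val_zpow_eq_zpow_val, ← map_zpow]
  rfl

theorem conj_tauUnit_zpow (n : ℤ) : conj ↑(tauUnit ^ n) = ψ ^ n := by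
  have h : (Units.map (conj : GoldenInt →* ℝ) tauUnit : ℝ) = ψ := by
    simp [tauUnit, conj_apply]
  rw [← h, ← Units.val_zpow_eq_zpow_val, ← map_zpow]
  rfl

theorem abs_conj_tauUnit_zpow (n : ℤ) : |conj ↑(tauUnit ^ n)| = (φ ^ n)⁻¹ := by
  rw [conj_tauUnit_zpow, abs_zpow, abs_of_neg Real.goldenConj_neg, ← Real.inv_goldenRatio, inv_zpow]

theorem mod5_tauUnit_pow_four (n : ℕ) : mod5 ↑(tauUnit ^ (4 * n)) = 1 := by
  have h : mod5 tauUnit = 3 := by simp [tauUnit, mod5_apply]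
  rw [Units.val_pow_eq_pow_val, map_pow, h, pow_mul, show (3 : ZMod 5) ^ 4 = 1 by decide, one_pow]

theorem toReal_inv_tauUnit : toReal ↑tauUnit⁻¹ = φ⁻¹ := by
  simpa using toReal_tauUnit_zpow (-1)

theorem conj_inv_tauUnit : conj ↑tauUnit⁻¹ = -φ := by
  rw [← zpow_neg_one, conj_tauUnit_zpow, zpow_neg_one, Real.inv_goldenConj]

theorem mod5_inv_tauUnit : mod5 ↑tauUnit⁻¹ = 2 := by
  rw [mod5_apply]
  decide

theorem eq_inv_tauUnit_or_le_abs_conj {t : GoldenInt} (h0 : 0 < toReal t) (h1 : toReal t < 1) :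
    t = ↑tauUnit⁻¹ ∨ t = ↑tauUnit⁻¹ ^ 2 ∨ φ ^ 3 ≤ |conj t| := by
  have hsq : ((tauUnit⁻¹ : GoldenIntˣ) : GoldenInt) ^ 2 = ⟨2, -1⟩ := by
    rw [sq]
    rfl
  have hcube : φ ^ 3 = 2 * φ + 1 := by linear_combination (φ + 1) * Real.goldenRatio_sq
  have hφ : 8 / 5 < φ := by
    nlinarith [Real.goldenRatio_sq, Real.one_lt_goldenRatio]
  have hφ2 := Real.goldenRatio_lt_two
  obtain ⟨a, b⟩ := t
  rw [hsq, hcube, conj_apply, ← Real.one_sub_goldenConj, le_abs']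
  rw [toReal_apply] at h0 h1
  dsimp only at h0 h1 ⊢
  obtain hb | rfl | rfl | rfl | rfl | hb :
      b ≤ -2 ∨ b = -1 ∨ b = 0 ∨ b = 1 ∨ b = 2 ∨ 3 ≤ b := by lia
  · have hb' : (b : ℝ) ≤ -2 := mod_cast hb
    exact .inr (.inr (.inr (by nlinarith)))
  · have ha0 : (1 : ℝ) < a := by push_cast at h0; linarith
    have ha1 : (a : ℝ) < 3 := by push_cast at h1; linarith
    obtain rfl : a = 2 := by norm_cast at ha0 ha1; lia
    exact .inr (.inl rfl)
  · norm_num at h0 h1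
    norm_cast at h0 h1
    lia
  · have ha0 : (-2 : ℝ) < a := by push_cast at h0; linarith
    have ha1 : (a : ℝ) < 0 := by push_cast at h1; linarith
    obtain rfl : a = -1 := by norm_cast at ha0 ha1; lia
    exact .inl rfl
  · have ha : (a : ℝ) < -2 := by push_cast at h1; linarith
    have ha' : (a : ℝ) ≤ -3 := by norm_cast at ha ⊢; lia
    exact .inr (.inr (.inl (by push_cast; linarith)))
  · have hb' : (3 : ℝ) ≤ b := mod_cast hb
    exact .inr (.inr (.inl (by nlinarith)))

/-! ### The zeta function of `ℚ(√5)` as a sum over ideals of `ℤ[τ]` -/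

theorem goldenRatio_mem_QSqrtFive : φ ∈ QSqrtFive :=
  div_mem (add_mem (one_mem _) (IntermediateField.mem_adjoin_simple_self ℚ _)) (ofNat_mem _ 2)

/-- The embedding `ω ↦ τ` of `ℤ[τ]` into `ℚ(√5)`, which realises `ℚ(√5)` as its fraction field. -/
def toField : GoldenInt →ₐ[ℤ] QSqrtFive :=
  QuadraticAlgebra.lift ⟨⟨φ, goldenRatio_mem_QSqrtFive⟩, by
    ext
    push_cast
    rw [one_smul, one_smul, ← sq, Real.goldenRatio_sq, add_comm]⟩

theorem coe_toField (a : GoldenInt) : (toField a : ℝ) = toReal a := by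
  simp [toField, toReal_apply]

theorem toReal_ne_zero {a : GoldenInt} (ha : a ≠ 0) : toReal a ≠ 0 :=
  (map_ne_zero_iff _ toReal_injective).2 ha

theorem exists_eq_div {z : ℝ} (hz : z ∈ QSqrtFive) :
    ∃ x y : GoldenInt, y ≠ 0 ∧ z = toReal x / toReal y := by
  induction hz using IntermediateField.adjoin_induction with
  | mem x hx =>
    refine ⟨⟨-1, 2⟩, 1, one_ne_zero, ?_⟩
    rw [Set.mem_singleton_iff.1 hx, map_one, div_one, toReal_apply, Real.goldenRatio]
    push_cast
    ring
  | algebraMap q =>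
    refine ⟨q.num, q.den, Nat.cast_ne_zero.2 q.den_ne_zero, ?_⟩
    simp only [map_intCast, map_natCast, eq_ratCast]
    exact Rat.cast_def q
  | add x y _ _ hx hy =>
    obtain ⟨a, b, hb, rfl⟩ := hx
    obtain ⟨c, d, hd, rfl⟩ := hy
    refine ⟨a * d + b * c, b * d, mul_ne_zero hb hd, ?_⟩
    rw [div_add_div _ _ (toReal_ne_zero hb) (toReal_ne_zero hd), map_add, map_mul, map_mul, map_mul]
  | inv x _ hx =>
    obtain ⟨a, b, -, rfl⟩ := hx
    by_cases ha : a = 0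
    · exact ⟨0, 1, one_ne_zero, by simp [ha]⟩
    · exact ⟨b, a, ha, inv_div _ _⟩
  | mul x y _ _ hx hy =>
    obtain ⟨a, b, hb, rfl⟩ := hx
    obtain ⟨c, d, hd, rfl⟩ := hy
    exact ⟨a * c, b * d, mul_ne_zero hb hd, by rw [div_mul_div_comm, map_mul, map_mul]⟩

instance : Algebra GoldenInt QSqrtFive := toField.toRingHom.toAlgebra

theorem coe_algebraMap (a : GoldenInt) : (algebraMap GoldenInt QSqrtFive a : ℝ) = toReal a :=
  coe_toField a

instance : FaithfulSMul GoldenInt QSqrtFive :=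
  (faithfulSMul_iff_algebraMap_injective _ _).2 fun a b h ↦
    toReal_injective (by rw [← coe_algebraMap, h, coe_algebraMap])

instance : IsFractionRing GoldenInt QSqrtFive := by
  refine IsFractionRing.of_field _ _ fun z ↦ ?_
  obtain ⟨x, y, -, h⟩ := exists_eq_div z.2
  refine ⟨x, y, Subtype.ext ?_⟩
  rw [h, IntermediateField.coe_div, coe_algebraMap, coe_algebraMap]

/-- `ℤ[τ]`, being integrally closed, is the ring of integers of `ℚ(√5)`. -/
def ringOfIntegersEquiv : NumberField.RingOfIntegers QSqrtFive ≃+* GoldenInt :=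
  haveI : Algebra.IsIntegral ℤ GoldenInt := Algebra.IsIntegral.of_finite ℤ GoldenInt
  haveI : IsIntegralClosure GoldenInt ℤ QSqrtFive :=
    IsIntegralClosure.of_isIntegrallyClosed GoldenInt ℤ QSqrtFive
  NumberField.RingOfIntegers.equiv GoldenInt

theorem absNorm_idealComapOrderIso (I : Ideal GoldenInt) :
    Ideal.absNorm (ringOfIntegersEquiv.idealComapOrderIso I) = Ideal.absNorm I := by
  rw [Ideal.absNorm_apply, Ideal.absNorm_apply, Submodule.cardQuot_apply, Submodule.cardQuot_apply]
  refine Nat.card_congr (Ideal.quotientEquiv _ _ ringOfIntegersEquiv ?_).toEquiv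
  exact (Ideal.map_comap_of_surjective _ ringOfIntegersEquiv.surjective I).symm

/-- The summand `N(I)⁻²` of `ζ_K(2)`. -/
def normInvSq : Ideal GoldenInt →*₀ ℝ where
  toFun I := ((Ideal.absNorm I : ℝ) ^ 2)⁻¹
  map_zero' := by simp
  map_one' := by simp
  map_mul' I J := by simp [mul_pow, mul_comm]

theorem normInvSq_apply (I : Ideal GoldenInt) : normInvSq I = ((Ideal.absNorm I : ℝ) ^ 2)⁻¹ := rfl

theorem ofReal_normInvSq (I : Ideal GoldenInt) :
    (normInvSq I : ℂ) =
      (Ideal.absNorm (ringOfIntegersEquiv.idealComapOrderIso I) : ℂ) ^ (-2 : ℂ) := by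
  rw [normInvSq_apply, absNorm_idealComapOrderIso, Complex.cpow_neg, Complex.cpow_ofNat]
  push_cast
  rfl

theorem summable_normInvSq : Summable normInvSq := by
  rw [← Complex.summable_ofReal]
  refine (summable_congr ofReal_normInvSq).2
    ((ringOfIntegersEquiv.idealComapOrderIso.toEquiv.summable_iff
      (f := fun I ↦ (Ideal.absNorm I : ℂ) ^ (-2 : ℂ))).2 (summable_absNorm_cpow_neg ?_))
  norm_num

theorem dedekindZeta_two :
    NumberField.dedekindZeta QSqrtFive 2 = ((∑' I, normInvSq I : ℝ) : ℂ) := by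
  have h2 : 1 < (2 : ℂ).re := by norm_num
  rw [dedekindZeta_eq_tsum_absNorm_cpow_neg h2, Complex.ofReal_tsum, tsum_congr ofReal_normInvSq]
  exact (ringOfIntegersEquiv.idealComapOrderIso.toEquiv.tsum_eq
    fun I ↦ (Ideal.absNorm I : ℂ) ^ (-2 : ℂ)).symm

/-! ### The Möbius sum over the ideals prime to `5` -/

instance : Fact (Nat.Prime 5) := ⟨Nat.prime_five⟩

/-- The prime ideal `(√5)` above `5`. -/
def fivePrime : Ideal GoldenInt := RingHom.ker mod5

theorem fivePrime_dvd_span_singleton {d : GoldenInt} :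
    fivePrime ∣ Ideal.span {d} ↔ mod5 d = 0 := by
  rw [Ideal.dvd_span_singleton]
  exact RingHom.mem_ker

theorem absNorm_fivePrime : Ideal.absNorm fivePrime = 5 := by
  have hsurj : Function.Surjective mod5 := ZMod.ringHom_surjective mod5.toRingHom
  rw [Ideal.absNorm_apply, Submodule.cardQuot_apply]
  exact (Nat.card_congr (Ideal.quotientKerAlgEquivOfSurjective hsurj).toEquiv).trans
    (Nat.card_zmod 5)

theorem prime_fivePrime : Prime fivePrime :=
  Ideal.prime_of_isPrime (fun h ↦ by simpa [h] using absNorm_fivePrime) (RingHom.ker_isPrime mod5)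

theorem tsum_moebius_mul_normInvSq_not_dvd :
    ∑' I : ({I | fivePrime ∣ I}ᶜ : Set (Ideal GoldenInt)),
        (UniqueFactorizationMonoid.moebius I.1 : ℝ) * normInvSq I =
      25 / 24 / ∑' I, normInvSq I := by
  have h := one_sub_mul_tsum_moebius_mul_tsum prime_fivePrime summable_normInvSq
  have h5 : normInvSq fivePrime = 1 / 25 := by
    rw [normInvSq_apply, absNorm_fivePrime]
    norm_num
  rw [h5] at h
  rw [eq_div_iff (right_ne_zero_of_mul_eq_one h)]
  linarith

end GoldenInt

/-! ### The fifth root of unity -/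

theorem goldenRatio_mem_Ioo : φ ∈ Set.Ioo (1.618 : ℝ) 1.6181 := by
  constructor <;> nlinarith [Real.goldenRatio_sq, Real.goldenRatio_pos]

theorem norm_zeta5 : ‖zeta5‖ = 1 := zeta5_isPrimitiveRoot.norm'_eq_one (by norm_num)

theorem zeta5_re : zeta5.re = (φ - 1) / 2 := by
  have hcos : zeta5.re = Real.cos (2 * (Real.pi / 5)) := by
    rw [← mul_div_assoc, zeta5]
    simp [Complex.exp_re]
  rw [hcos, Real.cos_two_mul, Real.cos_pi_div_five, Real.goldenRatio]
  linear_combination (1 / 8) * Real.sq_sqrt (show (0 : ℝ) ≤ 5 by norm_num)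

theorem zeta5_im_pos : 0 < zeta5.im := by
  have hsin : zeta5.im = Real.sin (2 * Real.pi / 5) := by
    rw [zeta5]
    simp [Complex.exp_im]
  rw [hsin]
  exact Real.sin_pos_of_pos_of_lt_pi (by positivity) (by linarith [Real.pi_pos])

theorem zeta5_im_sq : zeta5.im ^ 2 = (φ + 2) / 4 := by
  have h := Complex.sq_norm zeta5
  rw [norm_zeta5, Complex.normSq_apply, zeta5_re] at h
  linear_combination (-1 : ℝ) * h - (1 / 4) * Real.goldenRatio_sq

theorem zeta5_sq_re : (zeta5 ^ 2).re = -φ / 2 := by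
  rw [sq, Complex.mul_re, ← sq, ← sq, zeta5_im_sq, zeta5_re]
  linear_combination (1 / 4) * Real.goldenRatio_sq

theorem zeta5_sq_im : (zeta5 ^ 2).im = (φ - 1) * zeta5.im := by
  rw [sq, Complex.mul_im, zeta5_re]
  ring

/-! ### `ℤ[τ] × ℤ[τ]` as a lattice in `ℂ × ℂ` -/

open GoldenInt

/-- The point `a + bζ` of the plane, where `(a, b)` are the coordinates of an element of `ℤ[ζ]` in
its `ℤ[τ]`-basis `1, ζ`. -/
def physical : GoldenInt × GoldenInt →+ ℂ where
  toFun x := toReal x.1 + toReal x.2 * zeta5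
  map_zero' := by simp
  map_add' x y := by
    simp only [Prod.fst_add, Prod.snd_add, map_add, Complex.ofReal_add]
    ring

/-- The conjugate point `σ(a + bζ)`. -/
def internal : GoldenInt × GoldenInt →+ ℂ where
  toFun x := conj x.1 + conj x.2 * zeta5 ^ 2
  map_zero' := by simp
  map_add' x y := by
    simp only [Prod.fst_add, Prod.snd_add, map_add, Complex.ofReal_add]
    ring

/-- The residue `κ(a + bζ)`. -/
def residue : GoldenInt × GoldenInt →+ ZMod 5 :=
  mod5.toLinearMap.toAddMonoidHom.coprod mod5.toLinearMap.toAddMonoidHom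

theorem physical_apply (x : GoldenInt × GoldenInt) :
    physical x = toReal x.1 + toReal x.2 * zeta5 := rfl

theorem internal_apply (x : GoldenInt × GoldenInt) :
    internal x = conj x.1 + conj x.2 * zeta5 ^ 2 := rfl

theorem residue_apply (x : GoldenInt × GoldenInt) : residue x = mod5 x.1 + mod5 x.2 := rfl

theorem physical_smul (d : GoldenInt) (x : GoldenInt × GoldenInt) :
    physical (d • x) = toReal d * physical x := by
  simp [physical_apply, mul_add, mul_assoc]

theorem internal_smul (d : GoldenInt) (x : GoldenInt × GoldenInt) :
    internal (d • x) = conj d * internal x := by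
  simp [internal_apply, mul_add, mul_assoc]

theorem residue_smul (d : GoldenInt) (x : GoldenInt × GoldenInt) :
    residue (d • x) = mod5 d * residue x := by
  simp [residue_apply, mul_add]

/-- Generators of the kernel of `residue` over `ℤ`. -/
def kernelGen : Fin 4 → GoldenInt × GoldenInt :=
  ![(⟨5, 0⟩, 0), (⟨2, 1⟩, 0), (⟨-1, 0⟩, ⟨1, 0⟩), (⟨2, 0⟩, ⟨0, 1⟩)]

/-- The element with integer coordinates `v` in the coset of the kernel of `residue` that contains
`(c, 0)`. -/
def cosetPoint (c : ℤ) (v : Fin 4 → ℤ) : GoldenInt × GoldenInt :=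
  ∑ i, v i • kernelGen i + ((c : GoldenInt), 0)

theorem cosetPoint_eq (c : ℤ) (v : Fin 4 → ℤ) :
    cosetPoint c v = (⟨c + 5 * v 0 + 2 * v 1 - v 2 + 2 * v 3, v 1⟩, ⟨v 2, v 3⟩) := by
  rw [cosetPoint, Fin.sum_univ_four]
  ext <;> simp [kernelGen]
  ring

theorem cosetPoint_injective (c : ℤ) : Function.Injective (cosetPoint c) := by
  intro v w h
  simp only [cosetPoint_eq, Prod.mk.injEq, QuadraticAlgebra.mk.injEq] at h
  obtain ⟨⟨h0, h1⟩, h2, h3⟩ := h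
  refine funext (Fin.forall_fin_succ.2 ⟨by lia, ?_⟩)
  simpa [Fin.forall_fin_succ] using ⟨h1, h2, h3⟩

theorem residue_cosetPoint (c : ℤ) (v : Fin 4 → ℤ) : residue (cosetPoint c v) = c := by
  have h5 : (5 : ZMod 5) = 0 := by decide
  rw [cosetPoint_eq, residue_apply, mod5_apply, mod5_apply]
  push_cast
  linear_combination ((v 0 : ZMod 5) + v 1 + v 3) * h5

theorem range_cosetPoint (c : ℤ) : Set.range (cosetPoint c) = {x | residue x = c} := by
  refine Set.Subset.antisymm (Set.range_subset_iff.2 (residue_cosetPoint c)) ?_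
  rintro ⟨⟨a, b⟩, d, e⟩ hx
  have hdvd : ((a + b * 3 + (d + e * 3) - c : ℤ) : ZMod 5) = 0 := by
    push_cast
    exact sub_eq_zero.2 (by simpa only [Set.mem_ofPred_eq, residue_apply, mod5_apply] using hx)
  obtain ⟨m, hm⟩ := (ZMod.intCast_zmod_eq_zero_iff_dvd _ 5).1 hdvd
  push_cast at hm
  refine ⟨![m - b - e, b, d, e], ?_⟩
  rw [cosetPoint_eq]
  ext <;> simp
  linarith

/-- The standard real basis of `ℂ × ℂ`. -/
def planeBasis : Module.Basis (Fin 4) ℝ (ℂ × ℂ) :=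
  (Complex.basisOneI.prod Complex.basisOneI).reindex finSumFinEquiv

theorem planeBasis_repr (x : ℂ × ℂ) :
    ⇑(planeBasis.repr x) = ![x.1.re, x.1.im, x.2.re, x.2.im] := by
  have hsymm : ⇑(finSumFinEquiv (m := 2) (n := 2)).symm = ![.inl 0, .inl 1, .inr 0, .inr 1] := by
    decide
  funext i
  rw [planeBasis, Module.Basis.repr_reindex_apply, hsymm]
  fin_cases i <;> simp

instance : (volume : Measure (ℂ × ℂ)).IsAddHaarMeasure :=
  inferInstanceAs ((volume : Measure ℂ).prod (volume : Measure ℂ)).IsAddHaarMeasure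

theorem volume_fundamentalDomain_planeBasis : volume (ZSpan.fundamentalDomain planeBasis) = 1 := by
  have hplane : Complex.basisOneI.addHaar = volume := by
    rw [← Complex.toBasis_orthonormalBasisOneI, OrthonormalBasis.addHaar_eq_volume]
  have hvol : planeBasis.addHaar = volume := by
    rw [planeBasis, Module.Basis.addHaar_reindex, Module.Basis.prod_addHaar, hplane,
      Measure.volume_eq_prod]
  rw [measure_congr (ZSpan.fundamentalDomain_ae_parallelepiped planeBasis volume), ← hvol,
    Module.Basis.addHaar_self]

theorem planeBasis_det_kernelGen :
    planeBasis.det (fun i ↦ (physical (kernelGen i), internal (kernelGen i))) =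
      -(25 * √5 / 4) := by
  have hM : planeBasis.toMatrix (fun i ↦ (physical (kernelGen i), internal (kernelGen i))) =
      !![5, 2 + φ, -1 + zeta5.re, 2 + φ * zeta5.re;
        0, 0, zeta5.im, φ * zeta5.im;
        5, 2 + ψ, -1 + (zeta5 ^ 2).re, 2 + ψ * (zeta5 ^ 2).re;
        0, 0, (zeta5 ^ 2).im, ψ * (zeta5 ^ 2).im] := by
    ext i j
    rw [Module.Basis.toMatrix_apply, planeBasis_repr]
    fin_cases j <;> fin_cases i <;>
      simp [kernelGen, physical_apply, internal_apply, toReal_apply, conj_apply]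
  rw [Module.Basis.det_apply, hM, zeta5_sq_im, ← Real.goldenRatio_sub_goldenConj,
    ← Real.one_sub_goldenConj]
  simp [Matrix.det_succ_row_zero, Fin.sum_univ_succ, Fin.succAbove]
  linear_combination (-5 * (φ - 1) * (2 * φ - 1) ^ 2) * zeta5_im_sq
    - (5 / 4) * (4 * (2 * φ - 1) + 5 + 4 * (φ ^ 2 - φ - 1)) * Real.goldenRatio_sq

theorem linearIndependent_kernelGen_and_span_eq_top :
    LinearIndependent ℝ (fun i ↦ (physical (kernelGen i), internal (kernelGen i))) ∧
      Submodule.span ℝ (Set.range fun i ↦ (physical (kernelGen i), internal (kernelGen i))) =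
        ⊤ := by
  rw [Module.Basis.is_basis_iff_det planeBasis, planeBasis_det_kernelGen]
  simp

/-- The embedding `x ↦ (x, σ(x))` maps the kernel of `residue` onto the lattice with this basis. -/
def kernelBasis : Module.Basis (Fin 4) ℝ (ℂ × ℂ) :=
  .mk linearIndependent_kernelGen_and_span_eq_top.1
    linearIndependent_kernelGen_and_span_eq_top.2.ge

theorem kernelBasis_apply (i : Fin 4) :
    kernelBasis i = (physical (kernelGen i), internal (kernelGen i)) :=
  Module.Basis.mk_apply linearIndependent_kernelGen_and_span_eq_top.1
    linearIndependent_kernelGen_and_span_eq_top.2.ge i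

/-- The image of `kernelBasis` under the scaling of the two planes by `r₁` and `r₂`. -/
def scaledKernelBasis {r₁ r₂ : ℝ} (h₁ : r₁ ≠ 0) (h₂ : r₂ ≠ 0) : Module.Basis (Fin 4) ℝ (ℂ × ℂ) :=
  kernelBasis.map
    ((LinearEquiv.smulOfNeZero ℝ ℂ r₁ h₁).prodCongr (LinearEquiv.smulOfNeZero ℝ ℂ r₂ h₂))

section

variable {r₁ r₂ : ℝ} (h₁ : r₁ ≠ 0) (h₂ : r₂ ≠ 0)

theorem scaledKernelBasis_apply (i : Fin 4) : scaledKernelBasis h₁ h₂ i =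
    (r₁ • physical (kernelGen i), r₂ • internal (kernelGen i)) := by
  rw [scaledKernelBasis, Module.Basis.map_apply, kernelBasis_apply]
  rfl

theorem latticePoint_scaledKernelBasis (c : ℤ) (v : Fin 4 → ℤ) :
    latticePoint (scaledKernelBasis h₁ h₂) v +
        (r₁ • physical ((c : GoldenInt), 0), r₂ • internal ((c : GoldenInt), 0)) =
      (r₁ • physical (cosetPoint c v), r₂ • internal (cosetPoint c v)) := by
  simp only [latticePoint, cosetPoint, scaledKernelBasis_apply, map_add, map_sum, smul_add,
    Finset.smul_sum, Prod.ext_iff, Prod.fst_add, Prod.snd_add, Prod.fst_sum, Prod.snd_sum,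
    Prod.smul_mk, map_zsmul, ← Int.cast_smul_eq_zsmul ℝ, smul_comm r₁, smul_comm r₂, and_self]

theorem volume_real_fundamentalDomain_scaledKernelBasis :
    volume.real (ZSpan.fundamentalDomain (scaledKernelBasis h₁ h₂)) =
      (r₁ * r₂) ^ 2 * (25 * √5 / 4) := by
  let f : ℂ × ℂ →ₗ[ℝ] ℂ × ℂ := (r₁ • LinearMap.id).prodMap (r₂ • LinearMap.id)
  have hf : ⇑(scaledKernelBasis h₁ h₂) =
      f ∘ fun i ↦ (physical (kernelGen i), internal (kernelGen i)) :=
    funext (scaledKernelBasis_apply h₁ h₂)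
  have hdet : LinearMap.det f = (r₁ * r₂) ^ 2 := by
    simp [f, LinearMap.det_prodMap, LinearMap.det_smul, Complex.finrank_real_complex, mul_pow]
  rw [Measure.real, ZSpan.measure_fundamentalDomain _ _ planeBasis,
    volume_fundamentalDomain_planeBasis, mul_one, ENNReal.toReal_ofReal (abs_nonneg _), hf,
    Module.Basis.det_comp, hdet, planeBasis_det_kernelGen, mul_neg, abs_neg,
    abs_of_nonneg (by positivity)]

end

theorem JordanMeasurable.volume_frontier_prod {D W : Set ℂ} (hD : JordanMeasurable D)
    (hW : JordanMeasurable W) : volume (frontier (D ×ˢ W)) = 0 := by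
  rw [frontier_prod_eq, Measure.volume_eq_prod, measure_union_null_iff, Measure.prod_prod,
    Measure.prod_prod, hD.2, hW.2, mul_zero, zero_mul]
  exact ⟨rfl, rfl⟩

theorem tendsto_ncard_residue_eq {α : Type*} {l : Filter α} {D W : Set ℂ}
    (hD : JordanMeasurable D) (hW : JordanMeasurable W) (c : ZMod 5) {r₁ r₂ : α → ℝ}
    (h₁ : ∀ j, r₁ j ≠ 0) (h₂ : ∀ j, r₂ j ≠ 0) (hr₁ : Tendsto r₁ l (𝓝 0))
    (hr₂ : Tendsto r₂ l (𝓝 0)) :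
    Tendsto (fun j ↦
      ({x | residue x = c ∧ r₁ j • physical x ∈ D ∧ r₂ j • internal x ∈ W}.ncard : ℝ) *
        ((r₁ j * r₂ j) ^ 2 * (25 * √5 / 4))) l (𝓝 (volume.real D * volume.real W)) := by
  obtain ⟨c, rfl⟩ := ZMod.intCast_surjective c
  have hzero (i : Fin 4) : Tendsto (fun j ↦ scaledKernelBasis (h₁ j) (h₂ j) i) l (𝓝 0) := by
    simp only [scaledKernelBasis_apply]
    have h := (hr₁.smul_const (physical (kernelGen i))).prodMk_nhds
      (hr₂.smul_const (internal (kernelGen i)))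
    rwa [zero_smul, zero_smul, Prod.mk_zero_zero] at h
  have hlim := tendsto_ncard_latticePoint_mul (hD.1.prod hW.1) (hD.volume_frontier_prod hW) hzero
    fun j ↦ (r₁ j • physical (c, 0), r₂ j • internal (c, 0))
  rw [Measure.volume_eq_prod, measureReal_prod_prod] at hlim
  refine hlim.congr fun j ↦ ?_
  rw [← Measure.volume_eq_prod, volume_real_fundamentalDomain_scaledKernelBasis,
    ← Set.ncard_image_of_injective _ (cosetPoint_injective c)]
  congr 3
  ext x
  simp only [latticePoint_scaledKernelBasis, Set.mem_image, Set.mem_ofPred_eq, Set.mem_prod]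
  constructor
  · rintro ⟨v, hv, rfl⟩
    exact ⟨residue_cosetPoint c v, hv⟩
  · rintro ⟨hx, hx'⟩
    obtain ⟨v, rfl⟩ := (range_cosetPoint c).ge hx
    exact ⟨v, hx', rfl⟩

/-! ### Points with a given divisor -/

/-- The nonzero points whose physical and internal coordinates lie in closed discs of radii `R₁`
and `R₂` about the origin. -/
def discPoints (R₁ R₂ : ℝ) : Set (GoldenInt × GoldenInt) :=
  {x | x ≠ 0 ∧ ‖physical x‖ ≤ R₁ ∧ ‖internal x‖ ≤ R₂}

theorem smul_mem_discPoints {d : GoldenInt} (hd : d ≠ 0) {x : GoldenInt × GoldenInt} {R₁ R₂ : ℝ}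
    (hx : x ∈ discPoints R₁ R₂) : d • x ∈ discPoints (|toReal d| * R₁) (|conj d| * R₂) := by
  refine ⟨fun h ↦ hx.1 (smul_right_injective _ hd (by simpa using h)), ?_, ?_⟩
  · rw [physical_smul, norm_mul, Complex.norm_real, Real.norm_eq_abs]
    exact mul_le_mul_of_nonneg_left hx.2.1 (abs_nonneg _)
  · rw [internal_smul, norm_mul, Complex.norm_real, Real.norm_eq_abs]
    exact mul_le_mul_of_nonneg_left hx.2.2 (abs_nonneg _)

/-- Multiplication by `5` maps into the kernel of `residue`, whose basis is known. -/
theorem exists_finite_ncard_discPoints_self_le : ∃ C : ℝ, 0 < C ∧ ∀ ρ, 0 ≤ ρ →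
    (discPoints ρ ρ).Finite ∧ ((discPoints ρ ρ).ncard : ℝ) ≤ (C * ρ) ^ 4 := by
  obtain ⟨C, hC, hbound⟩ :=
    exists_finite_ncard_latticePoint_le (scaledKernelBasis one_ne_zero one_ne_zero)
  refine ⟨C * 5, by positivity, fun ρ hρ ↦ ?_⟩
  obtain ⟨hfin, hcard⟩ := hbound (5 * ρ) (by positivity)
  have hinj := smul_right_injective (GoldenInt × GoldenInt) (show (5 : GoldenInt) ≠ 0 by decide)
  have hmaps : Set.MapsTo (fun x ↦ (5 : GoldenInt) • x) (discPoints ρ ρ) (cosetPoint 0 ''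
      {v | v ≠ 0 ∧ ‖latticePoint (scaledKernelBasis one_ne_zero one_ne_zero) v‖ ≤ 5 * ρ}) := by
    intro x hx
    have h5 : mod5 5 = 0 := by rw [map_ofNat]; decide
    obtain ⟨v, hv⟩ := (range_cosetPoint 0).ge
      (show residue ((5 : GoldenInt) • x) = (0 : ℤ) by
        rw [residue_smul, h5, zero_mul, Int.cast_zero])
    have hmem := smul_mem_discPoints (d := 5) (by decide) hx
    have hlat := latticePoint_scaledKernelBasis one_ne_zero one_ne_zero 0 v
    simp only [Int.cast_zero, Prod.mk_zero_zero, map_zero, smul_zero, add_zero, one_smul,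
      hv] at hlat
    simp only [discPoints, map_ofNat, Nat.abs_ofNat] at hmem
    refine ⟨v, ⟨?_, by rw [hlat]; exact max_le hmem.2.1 hmem.2.2⟩, hv⟩
    rintro rfl
    exact hmem.1 (hv ▸ by simp [cosetPoint])
  have hfin' := hfin.image (cosetPoint 0)
  refine ⟨hfin'.of_injOn hmaps hinj.injOn, ?_⟩
  have hle := Set.ncard_le_ncard_of_injOn _ hmaps hinj.injOn hfin'
  rw [Set.ncard_image_of_injective _ (cosetPoint_injective 0)] at hle
  refine le_trans (mod_cast hle) (hcard.trans_eq ?_)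
  rw [Fintype.card_fin, mul_assoc]

/-- Multiplication by a power of `τ` reduces to the case of two nearly equal radii. -/
theorem exists_finite_ncard_discPoints_le : ∃ C : ℝ, 0 < C ∧ ∀ R₁ R₂ : ℝ, 0 < R₁ → 0 < R₂ →
    (discPoints R₁ R₂).Finite ∧ ((discPoints R₁ R₂).ncard : ℝ) ≤ C * (R₁ * R₂) ^ 2 := by
  obtain ⟨C, hC, hbound⟩ := exists_finite_ncard_discPoints_self_le
  refine ⟨(C * 2) ^ 4, by positivity, fun R₁ R₂ h₁ h₂ ↦ ?_⟩
  set q := √(R₁ / R₂)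
  have hq : 0 < q := Real.sqrt_pos.2 (by positivity)
  have hqq : q ^ 2 * R₂ = R₁ := by
    rw [Real.sq_sqrt (by positivity)]
    field_simp
  obtain ⟨n, hn, hn'⟩ := exists_mem_Ico_zpow hq Real.one_lt_goldenRatio
  have hφn := zpow_pos Real.goldenRatio_pos n
  rw [zpow_add_one₀ Real.goldenRatio_ne_zero] at hn'
  have hu : ((tauUnit ^ (-n) : GoldenIntˣ) : GoldenInt) ≠ 0 := Units.ne_zero _
  have hmaps : Set.MapsTo (fun x ↦ ((tauUnit ^ (-n) : GoldenIntˣ) : GoldenInt) • x)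
      (discPoints R₁ R₂) (discPoints (2 * (q * R₂)) (2 * (q * R₂))) := fun x hx ↦ by
    have hmem := smul_mem_discPoints hu hx
    rw [toReal_tauUnit_zpow, abs_conj_tauUnit_zpow, zpow_neg, inv_inv,
      abs_of_pos (inv_pos.2 hφn)] at hmem
    refine ⟨hmem.1, hmem.2.1.trans ?_, hmem.2.2.trans ?_⟩
    · rw [inv_mul_le_iff₀ hφn, ← hqq]
      nlinarith [Real.goldenRatio_lt_two, mul_pos hq h₂, mul_pos (mul_pos hq h₂) hφn]
    · nlinarith [mul_pos hq h₂]
  obtain ⟨hfin, hcard⟩ := hbound (2 * (q * R₂)) (by positivity)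
  have hinj := (smul_right_injective (GoldenInt × GoldenInt) hu).injOn (s := discPoints R₁ R₂)
  refine ⟨hfin.of_injOn hmaps hinj, le_trans ?_ (hcard.trans_eq ?_)⟩
  · exact_mod_cast Set.ncard_le_ncard_of_injOn _ hmaps hinj hfin
  · rw [← hqq]
    ring

/-- The points of residue `k` with physical coordinate in `T • D` and internal coordinate in `W`. -/
def region (k : ZMod 5) (D W : Set ℂ) (T : ℝ) : Set (GoldenInt × GoldenInt) :=
  {x | residue x = k ∧ physical x ∈ T • D ∧ internal x ∈ W}

theorem region_inter_range_smul (k : ZMod 5) (D W : Set ℂ) (T : ℝ) (d : GoldenInt) :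
    region k D W T ∩ Set.range (d • ·) = (d • ·) ''
      {y | mod5 d * residue y = k ∧ toReal d * physical y ∈ T • D ∧ conj d * internal y ∈ W} := by
  simp only [← residue_smul, ← physical_smul, ← internal_smul]
  exact (Set.image_preimage_eq_inter_range (f := (d • ·))).symm

theorem exists_finite_ncard_region_inter_range_smul_le {k : ZMod 5} (hk : k ≠ 0) {D W : Set ℂ}
    (hD : Bornology.IsBounded D) (hW : Bornology.IsBounded W) :
    ∃ C : ℝ, ∀ T : ℝ, 0 < T → ∀ d : GoldenInt, d ≠ 0 →
      (region k D W T ∩ Set.range (d • ·)).Finite ∧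
        ((region k D W T ∩ Set.range (d • ·)).ncard : ℝ) ≤ C * T ^ 2 / (toReal d * conj d) ^ 2 := by
  obtain ⟨C, hC, hbound⟩ := exists_finite_ncard_discPoints_le
  obtain ⟨r₁, hr₁, hD'⟩ := hD.exists_pos_norm_le
  obtain ⟨r₂, hr₂, hW'⟩ := hW.exists_pos_norm_le
  refine ⟨C * (r₁ * r₂) ^ 2, fun T hT d hd ↦ ?_⟩
  have hd₁ : 0 < |toReal d| := abs_pos.2 (toReal_ne_zero hd)
  have hd₂ : 0 < |conj d| := abs_pos.2 ((map_ne_zero_iff _ conj_injective).2 hd)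
  have hsub : {y | mod5 d * residue y = k ∧ toReal d * physical y ∈ T • D ∧
      conj d * internal y ∈ W} ⊆ discPoints (T * r₁ / |toReal d|) (r₂ / |conj d|) := by
    rintro y ⟨hres, ⟨z, hz, hzy⟩, hint⟩
    refine ⟨?_, ?_, ?_⟩
    · rintro rfl
      exact hk (by rw [← hres, map_zero, mul_zero])
    · rw [le_div_iff₀' hd₁, ← Real.norm_eq_abs, ← Complex.norm_real, ← norm_mul, ← hzy, norm_smul,
        Real.norm_of_nonneg hT.le]
      exact mul_le_mul_of_nonneg_left (hD' z hz) hT.le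
    · rw [le_div_iff₀' hd₂, ← Real.norm_eq_abs, ← Complex.norm_real, ← norm_mul]
      exact hW' _ hint
  obtain ⟨hfin, hcard⟩ := hbound (T * r₁ / |toReal d|) (r₂ / |conj d|) (by positivity)
    (by positivity)
  rw [region_inter_range_smul, Set.ncard_image_of_injective _ (smul_right_injective _ hd)]
  refine ⟨(hfin.subset hsub).image _, le_trans ?_ (hcard.trans_eq ?_)⟩
  · exact_mod_cast Set.ncard_le_ncard hsub hfin
  · rw [← sq_abs (toReal d * conj d), abs_mul]
    field_simp

theorem exists_nat_pow_two_mul_le {b : ℝ} (hb : 1 < b) :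
    ∃ m : ℝ → ℕ, Tendsto m atTop atTop ∧ ∀ T : ℝ, 1 ≤ T → b ^ (2 * m T) ≤ T := by
  have hb2 : 1 < b ^ 2 := one_lt_pow₀ hb two_ne_zero
  refine ⟨fun T ↦ ⌊Real.logb (b ^ 2) T⌋₊,
    tendsto_nat_floor_atTop.comp (Real.tendsto_logb_atTop hb2), fun T hT ↦ ?_⟩
  rw [pow_mul, ← Real.rpow_natCast]
  calc (b ^ 2) ^ (⌊Real.logb (b ^ 2) T⌋₊ : ℝ)
    _ ≤ (b ^ 2) ^ Real.logb (b ^ 2) T :=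
      Real.rpow_le_rpow_of_exponent_le hb2.le (Nat.floor_le (Real.logb_nonneg hb2 hT))
    _ = T := Real.rpow_logb (by positivity) hb2.ne' (by positivity)

theorem exists_unit_toReal_div_tendsto_zero : ∃ u : ℝ → GoldenIntˣ,
    (∀ T, mod5 (u T : GoldenInt) = 1) ∧ (∀ T, toReal (u T) * conj (u T) = 1) ∧
      Tendsto (fun T ↦ toReal (u T) / T) atTop (𝓝 0) ∧
        Tendsto (fun T ↦ conj (u T)) atTop (𝓝 0) := by
  obtain ⟨m, hm, hmT⟩ :=
    exists_nat_pow_two_mul_le (one_lt_pow₀ Real.one_lt_goldenRatio four_ne_zero)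
  have hreal (T : ℝ) : toReal ↑(tauUnit ^ (4 * m T)) = (φ ^ 4) ^ m T := by
    rw [← pow_mul]
    exact_mod_cast toReal_tauUnit_zpow (4 * m T : ℕ)
  have hconj (T : ℝ) : conj ↑(tauUnit ^ (4 * m T)) = ((φ ^ 4) ^ m T)⁻¹ := by
    rw [← pow_mul, ← inv_pow, Real.inv_goldenRatio,
      Even.neg_pow (Nat.even_mul.2 (.inl (by decide : Even 4)))]
    exact_mod_cast conj_tauUnit_zpow (4 * m T : ℕ)
  have hlim : Tendsto (fun T ↦ ((φ ^ 4) ^ m T)⁻¹) atTop (𝓝 0) :=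
    ((tendsto_pow_atTop_atTop_of_one_lt
      (one_lt_pow₀ Real.one_lt_goldenRatio four_ne_zero)).comp hm).inv_tendsto_atTop
  have hpos (T : ℝ) : 0 < (φ ^ 4) ^ m T := by positivity
  refine ⟨fun T ↦ tauUnit ^ (4 * m T), fun T ↦ mod5_tauUnit_pow_four (m T), fun T ↦ ?_, ?_, ?_⟩
  · rw [hreal, hconj, mul_inv_cancel₀ (hpos T).ne']
  · refine squeeze_zero' ?_ ?_ hlim <;> filter_upwards [eventually_ge_atTop 1] with T hT <;>
      rw [hreal]
    · positivity
    · rw [div_le_iff₀ (by positivity), ← div_eq_inv_mul, le_div_iff₀ (hpos T), ← sq, ← pow_mul,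
        mul_comm (m T)]
      exact hmT T hT
  · simpa only [hconj] using hlim

theorem range_mul_unit_smul (d : GoldenInt) (u : GoldenIntˣ) :
    Set.range (fun x : GoldenInt × GoldenInt ↦ (d * u) • x) = Set.range (d • ·) := by
  simp only [mul_smul]
  exact (MulAction.surjective u).range_comp (d • ·)

theorem region_inter_range_smul_of_mod5_ne_zero (k : ZMod 5) (D W : Set ℂ) {T : ℝ} (hT : T ≠ 0)
    {d : GoldenInt} (hd : mod5 d ≠ 0) :
    region k D W T ∩ Set.range (d • ·) = (d • ·) ''
      {y | residue y = k / mod5 d ∧ (toReal d / T) • physical y ∈ D ∧ conj d • internal y ∈ W} := by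
  rw [region_inter_range_smul]
  congr 1
  ext y
  rw [Set.mem_ofPred_eq, Set.mem_ofPred_eq, eq_div_iff hd, mul_comm (residue y),
    Set.mem_smul_set_iff_inv_smul_mem₀ hT, ← Complex.real_smul, smul_smul, ← Complex.real_smul,
    inv_mul_eq_div]

/-- Multiplying `d` by a large unit makes the rescalings of both planes tend to `0`. -/
theorem tendsto_ncard_region_inter_range_smul (k : ZMod 5) {D W : Set ℂ} (hD : JordanMeasurable D)
    (hW : JordanMeasurable W) {d : GoldenInt} (hd : mod5 d ≠ 0) :
    Tendsto (fun T : ℝ ↦ ((region k D W T ∩ Set.range (d • ·)).ncard : ℝ) / T ^ 2) atTop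
      (𝓝 (volume.real D * volume.real W * (4 / (25 * √5)) / (toReal d * conj d) ^ 2)) := by
  obtain ⟨u, hu_mod, hu_norm, hu_real, hu_conj⟩ := exists_unit_toReal_div_tendsto_zero
  have hd0 : d ≠ 0 := by
    rintro rfl
    exact hd (map_zero _)
  have hdu (T : ℝ) : d * u T ≠ 0 := mul_ne_zero hd0 (u T).ne_zero
  have hdu_mod (T : ℝ) : mod5 (d * u T) = mod5 d := by rw [map_mul, hu_mod, mul_one]
  let r₁ : ℝ → ℝ := fun T ↦ if T = 0 then 1 else toReal (d * u T) / T
  have hr₁ (T : ℝ) : r₁ T ≠ 0 := by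
    dsimp only [r₁]
    split_ifs with hT
    exacts [one_ne_zero, div_ne_zero (toReal_ne_zero (hdu T)) hT]
  have hr₁_eq {T : ℝ} (hT : 0 < T) : r₁ T = toReal (d * u T) / T := if_neg hT.ne'
  have hr₁_lim : Tendsto r₁ atTop (𝓝 0) := by
    refine (mul_zero (toReal d) ▸ hu_real.const_mul (toReal d)).congr' ?_
    filter_upwards [eventually_gt_atTop 0] with T hT
    rw [hr₁_eq hT, map_mul, mul_div_assoc]
  have hr₂_lim : Tendsto (fun T ↦ conj (d * u T)) atTop (𝓝 0) := by
    simpa only [map_mul, mul_zero] using hu_conj.const_mul (conj d)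
  have hlim := tendsto_ncard_residue_eq hD hW (k / mod5 d) hr₁
    (fun T ↦ (map_ne_zero_iff _ conj_injective).2 (hdu T)) hr₁_lim hr₂_lim
  refine ((hlim.mul_const (4 / (25 * √5))).div_const ((toReal d * conj d) ^ 2)).congr' ?_
  filter_upwards [eventually_gt_atTop 0] with T hT
  have hscale : r₁ T * conj (d * u T) = toReal d * conj d / T := by
    rw [hr₁_eq hT, map_mul, map_mul]
    linear_combination (toReal d * conj d / T) * hu_norm T
  have hnorm : toReal d * conj d ≠ 0 :=
    mul_ne_zero (toReal_ne_zero hd0) ((map_ne_zero_iff _ conj_injective).2 hd0)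
  rw [← range_mul_unit_smul d (u T), region_inter_range_smul_of_mod5_ne_zero k D W hT.ne'
    (hdu_mod T ▸ hd), Set.ncard_image_of_injective _ (smul_right_injective _ (hdu T)), hdu_mod,
    ← hr₁_eq hT, hscale]
  generalize toReal d * conj d = a at hnorm ⊢
  generalize Set.ncard _ = N
  field_simp

/-! ### The density of primitive points -/

section Primitive

open UniqueFactorizationMonoid

/-- The ideal generated by the coordinates of a point; the point is primitive when it is `1`. -/
def content (x : GoldenInt × GoldenInt) : Ideal GoldenInt := Ideal.span {x.1, x.2}

theorem content_eq_one_iff {x : GoldenInt × GoldenInt} : content x = 1 ↔ IsCoprime x.1 x.2 := by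
  rw [content, Ideal.span_insert, Ideal.one_eq_top, Ideal.sup_eq_top_iff_isCoprime]

theorem span_singleton_dvd_content {d : GoldenInt} {x : GoldenInt × GoldenInt} :
    Ideal.span {d} ∣ content x ↔ x ∈ Set.range fun y : GoldenInt × GoldenInt ↦ d • y := by
  rw [content, Ideal.dvd_iff_le, Ideal.span_le, Set.pair_subset_iff, SetLike.mem_coe,
    SetLike.mem_coe, Ideal.mem_span_singleton, Ideal.mem_span_singleton]
  constructor
  · rintro ⟨⟨a, ha⟩, ⟨b, hb⟩⟩
    exact ⟨(a, b), (Prod.ext ha hb).symm⟩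
  · rintro ⟨y, rfl⟩
    exact ⟨⟨y.1, rfl⟩, ⟨y.2, rfl⟩⟩

theorem content_eq_zero_iff {x : GoldenInt × GoldenInt} : content x = 0 ↔ x = 0 := by
  rw [content, Ideal.zero_eq_bot, Ideal.span_eq_bot, Prod.ext_iff]
  simp

theorem exists_eq_span_singleton (I : Ideal GoldenInt) : ∃ d, I = Ideal.span {d} :=
  (IsPrincipalIdealRing.principal I).principal

theorem normInvSq_span_singleton (d : GoldenInt) :
    normInvSq (Ideal.span {d}) = ((toReal d * conj d) ^ 2)⁻¹ := by
  rw [normInvSq_apply, absNorm_span_singleton, sq_abs]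

variable {k : ZMod 5} {D W : Set ℂ}

theorem sep_span_singleton_dvd_content (d : GoldenInt) (T : ℝ) :
    {x ∈ region k D W T | Ideal.span {d} ∣ content x} =
      region k D W T ∩ Set.range (d • ·) :=
  Set.ext fun _ ↦ and_congr_right fun _ ↦ span_singleton_dvd_content

theorem finite_region (hk : k ≠ 0) (hD : Bornology.IsBounded D) (hW : Bornology.IsBounded W)
    {T : ℝ} (hT : 0 < T) : (region k D W T).Finite := by
  obtain ⟨C, hC⟩ := exists_finite_ncard_region_inter_range_smul_le hk hD hW
  simpa using (hC T hT 1 one_ne_zero).1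

theorem sep_dvd_content_eq_empty (hk : k ≠ 0) {I : Ideal GoldenInt} (hI : fivePrime ∣ I) (T : ℝ) :
    {x ∈ region k D W T | I ∣ content x} = ∅ := by
  obtain ⟨d, rfl⟩ := exists_eq_span_singleton I
  refine Set.eq_empty_of_forall_notMem ?_
  rw [sep_span_singleton_dvd_content]
  rintro _ ⟨⟨hres, -⟩, y, rfl⟩
  refine hk ?_
  rw [← hres, residue_smul, fivePrime_dvd_span_singleton.1 hI, zero_mul]

theorem ncard_region_isCoprime_eq_tsum (hk : k ≠ 0) (hD : Bornology.IsBounded D)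
    (hW : Bornology.IsBounded W) {T : ℝ} (hT : 0 < T) :
    ({x ∈ region k D W T | IsCoprime x.1 x.2}.ncard : ℝ) =
      ∑' I : ({I | fivePrime ∣ I}ᶜ : Set (Ideal GoldenInt)),
        (moebius I.1 : ℝ) * {x ∈ region k D W T | I.1 ∣ content x}.ncard := by
  simp only [← content_eq_one_iff]
  rw [ncard_sep_eq_one_eq_tsum (finite_region hk hD hW hT)]
  · refine (tsum_subtype_eq_of_support_subset (s := {I | fivePrime ∣ I}ᶜ) ?_).symm
    refine Function.support_subset_iff'.2 fun I hI ↦ ?_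
    rw [sep_dvd_content_eq_empty hk (not_not.1 hI), Set.ncard_empty, Nat.cast_zero, mul_zero]
  · rintro x ⟨hres, -⟩ hx
    exact hk (by rw [← hres, content_eq_zero_iff.1 hx, map_zero])

theorem tendsto_ncard_region_dvd_content (hD : JordanMeasurable D) (hW : JordanMeasurable W)
    {I : Ideal GoldenInt} (hI : ¬ fivePrime ∣ I) :
    Tendsto (fun T : ℝ ↦ ({x ∈ region k D W T | I ∣ content x}.ncard : ℝ) / T ^ 2) atTop
      (𝓝 (volume.real D * volume.real W * (4 / (25 * √5)) * normInvSq I)) := by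
  obtain ⟨d, rfl⟩ := exists_eq_span_singleton I
  simp only [sep_span_singleton_dvd_content, normInvSq_span_singleton, ← div_eq_mul_inv]
  exact tendsto_ncard_region_inter_range_smul k hD hW (mt fivePrime_dvd_span_singleton.2 hI)

theorem exists_ncard_region_dvd_content_le (hk : k ≠ 0) (hD : Bornology.IsBounded D)
    (hW : Bornology.IsBounded W) : ∃ C : ℝ, ∀ T : ℝ, 0 < T → ∀ I : Ideal GoldenInt, I ≠ 0 →
      ({x ∈ region k D W T | I ∣ content x}.ncard : ℝ) / T ^ 2 ≤ C * normInvSq I := by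
  obtain ⟨C, hC⟩ := exists_finite_ncard_region_inter_range_smul_le hk hD hW
  refine ⟨C, fun T hT I hI ↦ ?_⟩
  obtain ⟨d, rfl⟩ := exists_eq_span_singleton I
  have hd : d ≠ 0 := mt Ideal.span_singleton_eq_bot.2 hI
  rw [sep_span_singleton_dvd_content, normInvSq_span_singleton, div_le_iff₀ (by positivity)]
  exact (hC T hT d hd).2.trans_eq (by ring)

theorem tendsto_ncard_region_isCoprime (hk : k ≠ 0) (hD : JordanMeasurable D)
    (hW : JordanMeasurable W) :
    Tendsto (fun T : ℝ ↦ ({x ∈ region k D W T | IsCoprime x.1 x.2}.ncard : ℝ) / T ^ 2) atTop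
      (𝓝 (volume.real D * volume.real W * (1 / (6 * √5)) / ∑' I, normInvSq I)) := by
  obtain ⟨C, hC⟩ := exists_ncard_region_dvd_content_le hk hD.1 hW.1
  have hlim := tendsto_tsum_of_dominated_convergence (𝓕 := atTop)
    (f := fun (T : ℝ) (I : ({I | fivePrime ∣ I}ᶜ : Set (Ideal GoldenInt))) ↦
      (moebius I.1 : ℝ) * (({x ∈ region k D W T | I.1 ∣ content x}.ncard : ℝ) / T ^ 2))
    (bound := fun I ↦ C * normInvSq I) ((summable_normInvSq.mul_left C).subtype _)
    (fun I ↦ (tendsto_ncard_region_dvd_content hD hW I.2).const_mul _) ?_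
  · simp only [mul_left_comm (moebius _ : ℝ)] at hlim
    rw [tsum_mul_left, tsum_moebius_mul_normInvSq_not_dvd] at hlim
    convert hlim.congr' ?_ using 2
    · field_simp
      ring
    · filter_upwards [eventually_gt_atTop 0] with T hT
      rw [ncard_region_isCoprime_eq_tsum hk hD.1 hW.1 hT, ← tsum_div_const]
      exact tsum_congr fun I ↦ (mul_div_assoc ..).symm
  · filter_upwards [eventually_gt_atTop 0] with T hT I
    have hI : I.1 ≠ 0 := fun h ↦ I.2 (h ▸ dvd_zero fivePrime)
    rw [norm_mul, Real.norm_eq_abs, Real.norm_of_nonneg (by positivity)]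
    exact (mul_le_of_le_one_left (by positivity) (abs_moebius_le_one _)).trans (hC T hT I hI)

end Primitive

/-! ### The ring `ℤ[ζ]` in coordinates -/

theorem ofReal_goldenRatio_sq : (φ : ℂ) ^ 2 = φ + 1 := by
  exact_mod_cast Real.goldenRatio_sq

theorem zeta5_sq : zeta5 ^ 2 = ((φ : ℂ) - 1) * zeta5 - 1 := by
  rw [← Complex.ofReal_one, ← Complex.ofReal_sub]
  apply Complex.ext
  · rw [zeta5_sq_re, Complex.sub_re, Complex.re_ofReal_mul, zeta5_re, Complex.ofReal_re]
    linear_combination (-1 / 2) * Real.goldenRatio_sq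
  · rw [zeta5_sq_im, Complex.sub_im, Complex.im_ofReal_mul, Complex.ofReal_im, sub_zero]

theorem zeta5_pow_four : zeta5 ^ 4 = -(φ : ℂ) * zeta5 ^ 2 - 1 := by
  linear_combination (zeta5 ^ 2 + (φ - 1) * zeta5 + 1) * zeta5_sq
    + zeta5 ^ 2 * ofReal_goldenRatio_sq

/-- Multiplication by `ζ` in the coordinates of `physical`; recall `ζ² = (τ - 1)ζ - 1`. -/
def zetaMul (x : GoldenInt × GoldenInt) : GoldenInt × GoldenInt :=
  (-x.2, x.1 + ↑tauUnit⁻¹ * x.2)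

theorem physical_zetaMul (x : GoldenInt × GoldenInt) :
    physical (zetaMul x) = zeta5 * physical x := by
  have hinv : ((φ⁻¹ : ℝ) : ℂ) = φ - 1 := by
    rw [Real.inv_goldenRatio, ← Real.one_sub_goldenRatio, Complex.ofReal_neg,
      Complex.ofReal_sub, Complex.ofReal_one]
    ring
  simp only [zetaMul, physical_apply, map_neg, map_add, map_mul, toReal_inv_tauUnit,
    Complex.ofReal_neg, Complex.ofReal_add, Complex.ofReal_mul, hinv]
  linear_combination (-toReal x.2 : ℂ) * zeta5_sq

theorem internal_zetaMul (x : GoldenInt × GoldenInt) :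
    internal (zetaMul x) = zeta5 ^ 2 * internal x := by
  simp only [zetaMul, internal_apply, map_neg, map_add, map_mul, conj_inv_tauUnit,
    Complex.ofReal_neg, Complex.ofReal_add, Complex.ofReal_mul]
  linear_combination (-conj x.2 : ℂ) * zeta5_pow_four

theorem residue_zetaMul (x : GoldenInt × GoldenInt) : residue (zetaMul x) = residue x := by
  simp only [zetaMul, residue_apply, map_neg, map_add, map_mul, mod5_inv_tauUnit]
  ring

/-- `x` has coordinates `m` in the basis `1, ζ` of `ℤ[ζ]` over `ℤ[τ]`, under the embedding in `ℂ`,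
`σ` and `κ`. -/
structure HasCoordinates (x : ZZeta) (m : GoldenInt × GoldenInt) : Prop where
  coe_eq : (x : ℂ) = physical m
  sigma_eq : sigma x = internal m
  kappa_eq : kappa x = residue m

namespace HasCoordinates

variable {x y : ZZeta} {m n : GoldenInt × GoldenInt}

theorem intCast (a : ℤ) : HasCoordinates a ((a : GoldenInt), 0) where
  coe_eq := by simp [physical_apply]
  sigma_eq := by simp [internal_apply]
  kappa_eq := by simp [residue_apply]

theorem add (hx : HasCoordinates x m) (hy : HasCoordinates y n) :
    HasCoordinates (x + y) (m + n) where
  coe_eq := by rw [Subalgebra.coe_add, map_add, hx.coe_eq, hy.coe_eq]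
  sigma_eq := by rw [map_add, map_add, hx.sigma_eq, hy.sigma_eq]
  kappa_eq := by rw [map_add, map_add, hx.kappa_eq, hy.kappa_eq]

theorem mul_zetaGen (hx : HasCoordinates x m) : HasCoordinates (x * zetaGen) (zetaMul m) where
  coe_eq := by rw [physical_zetaMul, ← hx.coe_eq, mul_comm x, Subalgebra.coe_mul, zetaGen]
  sigma_eq := by rw [map_mul, internal_zetaMul, ← hx.sigma_eq, sigma_zetaGen, mul_comm]
  kappa_eq := by rw [map_mul, residue_zetaMul, ← hx.kappa_eq, kappa_zetaGen, mul_one]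

end HasCoordinates

theorem exists_hasCoordinates (x : ZZeta) : ∃ m, HasCoordinates x m := by
  obtain ⟨f, rfl⟩ := zetaBasis.exists_eq_aeval' x
  rw [zetaBasis_gen]
  induction f using Polynomial.induction_on with
  | C a => exact ⟨_, by simpa using HasCoordinates.intCast a⟩
  | add f g hf hg =>
    obtain ⟨m, hm⟩ := hf
    obtain ⟨n, hn⟩ := hg
    exact ⟨m + n, by simpa only [map_add] using hm.add hn⟩
  | monomial n a ih =>
    obtain ⟨m, hm⟩ := ih
    exact ⟨zetaMul m, by simpa only [map_mul, map_pow, aeval_X, pow_succ, mul_assoc]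
      using hm.mul_zetaGen⟩

theorem neg_zeta5_sq_add_zeta5_pow_three : -(zeta5 ^ 2 + zeta5 ^ 3) = φ := by
  linear_combination (-(φ : ℂ) - zeta5) * zeta5_sq - zeta5 * ofReal_goldenRatio_sq

theorem neg_zeta5_pow_four_add_zeta5_pow_six : -(zeta5 ^ 4 + zeta5 ^ 6) = ψ := by
  have hψ : (ψ : ℂ) = 1 - φ := by
    rw [eq_sub_iff_add_eq', ← Complex.ofReal_add, Real.goldenRatio_add_goldenConj,
      Complex.ofReal_one]
  rw [hψ]
  linear_combination (-1 - zeta5 ^ 2) * zeta5_pow_four + (φ : ℂ) * zeta5_pow_four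
    - zeta5 ^ 2 * ofReal_goldenRatio_sq

theorem exists_hasCoordinates_of_pair (m : GoldenInt × GoldenInt) : ∃ x, HasCoordinates x m := by
  refine ⟨m.1.re + m.1.im * -(zetaGen ^ 2 + zetaGen ^ 3)
    + (m.2.re + m.2.im * -(zetaGen ^ 2 + zetaGen ^ 3)) * zetaGen, ?_, ?_, ?_⟩
  · rw [physical_apply, toReal_apply, toReal_apply]
    simp only [Complex.ofReal_add, Complex.ofReal_mul, Complex.ofReal_intCast,
      ← neg_zeta5_sq_add_zeta5_pow_three]
    rfl
  · rw [internal_apply, conj_apply, conj_apply]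
    simp only [Complex.ofReal_add, Complex.ofReal_mul, Complex.ofReal_intCast,
      ← neg_zeta5_pow_four_add_zeta5_pow_six]
    simp only [map_add, map_mul, map_neg, map_pow, map_intCast, sigma_zetaGen]
    ring
  · rw [residue_apply, mod5_apply, mod5_apply]
    simp only [map_add, map_mul, map_neg, map_pow, map_intCast, kappa_zetaGen, one_pow, mul_one,
      show -(1 + 1 : ZMod 5) = 3 by decide]

theorem lambdaSet_eq_image (k : ℕ) (ε : ℂ) :
    lambdaSet k ε = physical '' {x | residue x = k ∧ internal x ∈ window k ε} := by
  ext z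
  constructor
  · rintro ⟨x, rfl, hκ, hσ⟩
    obtain ⟨m, hm⟩ := exists_hasCoordinates x
    exact ⟨m, ⟨hm.kappa_eq ▸ hκ, hm.sigma_eq ▸ hσ⟩, hm.coe_eq.symm⟩
  · rintro ⟨m, ⟨hκ, hσ⟩, rfl⟩
    obtain ⟨x, hx⟩ := exists_hasCoordinates_of_pair m
    exact ⟨x, hx.coe_eq, hx.kappa_eq.trans hκ, hx.sigma_eq ▸ hσ⟩

theorem ofReal_mul_physical_eq_iff {x y : GoldenInt × GoldenInt} {t : ℝ} :
    (t : ℂ) * physical x = physical y ↔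
      t * toReal x.1 = toReal y.1 ∧ t * toReal x.2 = toReal y.2 := by
  constructor
  · intro h
    have him := congrArg Complex.im h
    have hre := congrArg Complex.re h
    simp only [physical_apply, Complex.add_re, Complex.add_im, Complex.ofReal_re,
      Complex.ofReal_im, Complex.re_ofReal_mul, Complex.im_ofReal_mul, zero_add] at him hre
    have hsnd : t * toReal x.2 = toReal y.2 :=
      mul_right_cancel₀ zeta5_im_pos.ne' (by rw [mul_assoc, him])
    exact ⟨by linear_combination hre - zeta5.re * hsnd, hsnd⟩
  · rintro ⟨hfst, hsnd⟩
    rw [physical_apply, physical_apply, ← hfst, ← hsnd]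
    push_cast
    ring

theorem physical_injective : Function.Injective physical := fun x y h ↦ by
  have hcoord := (ofReal_mul_physical_eq_iff (t := 1)).1 (by simpa using h)
  simp only [one_mul] at hcoord
  exact Prod.ext (toReal_injective hcoord.1) (toReal_injective hcoord.2)

theorem exists_eq_smul_of_isCoprime {x y : GoldenInt × GoldenInt} (hx : IsCoprime x.1 x.2)
    {t : ℝ} (h : (t : ℂ) * physical x = physical y) : ∃ c, toReal c = t ∧ y = c • x := by
  obtain ⟨u, v, huv⟩ := hx
  obtain ⟨hfst, hsnd⟩ := ofReal_mul_physical_eq_iff.1 h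
  have hc : toReal (u * y.1 + v * y.2) = t := by
    have hbezout := congrArg toReal huv
    simp only [map_add, map_mul, map_one] at hbezout ⊢
    rw [← hfst, ← hsnd]
    linear_combination t * hbezout
  refine ⟨_, hc, Prod.ext (toReal_injective ?_) (toReal_injective ?_)⟩
  · rw [← hfst, Prod.smul_fst, smul_eq_mul, map_mul, hc]
  · rw [← hsnd, Prod.smul_snd, smul_eq_mul, map_mul, hc]

/-! ### Windows -/

theorem pentagon_subset_closedBall : pentagon ⊆ Metric.closedBall 0 1 := by
  refine interior_subset.trans (convexHull_min ?_ (convex_closedBall 0 1))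
  rintro z (rfl | rfl | rfl | rfl | rfl) <;> simp [norm_zeta5]

theorem setOf_pow_five_eq_one :
    {z : ℂ | z ^ 5 = 1} = {1, zeta5, zeta5 ^ 2, zeta5 ^ 3, zeta5 ^ 4} := by
  ext z
  constructor
  · intro hz
    obtain ⟨i, hi, rfl⟩ := zeta5_isPrimitiveRoot.eq_pow_of_pow_eq_one hz
    interval_cases i <;> simp
  · have h5 := zeta5_isPrimitiveRoot.pow_eq_one
    rintro (rfl | rfl | rfl | rfl | rfl) <;> simp [h5, pow_right_comm zeta5 _ 5]

theorem ball_subset_pentagon : Metric.ball 0 (φ / 2) ⊆ pentagon := by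
  have hcos : Real.cos (Real.pi / (5 : ℕ)) = φ / 2 := by
    rw [Nat.cast_ofNat, Real.cos_pi_div_five, Real.goldenRatio]
    ring
  rw [pentagon, ← setOf_pow_five_eq_one, ← hcos]
  exact interior_maximal (ball_subset_convexHull_setOf_pow_eq_one (by norm_num)) Metric.isOpen_ball

/-- The image `s · 𝒲₁ + a` of the pentagon. -/
def affineCopy (s : ℝ) (a : ℂ) : Set ℂ := (fun w : ℂ ↦ (s : ℂ) * w + a) '' pentagon

theorem mem_affineCopy_iff {s : ℝ} (hs : s ≠ 0) {a z : ℂ} :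
    z ∈ affineCopy s a ↔ (z - a) / s ∈ pentagon := by
  have hs' : (s : ℂ) ≠ 0 := mod_cast hs
  constructor
  · rintro ⟨w, hw, rfl⟩
    rwa [add_sub_cancel_right, mul_div_cancel_left₀ w hs']
  · intro h
    exact ⟨_, h, by simp only [mul_div_cancel₀ _ hs', sub_add_cancel]⟩

theorem mul_mem_affineCopy_iff {c s : ℝ} (hc : c ≠ 0) (hs : s ≠ 0) {a z : ℂ} :
    (c : ℂ) * z ∈ affineCopy s a ↔ z ∈ affineCopy (s / c) (a / c) := by
  have hc' : (c : ℂ) ≠ 0 := mod_cast hc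
  rw [mem_affineCopy_iff hs, mem_affineCopy_iff (div_ne_zero hs hc), Complex.ofReal_div,
    div_div_eq_mul_div, sub_mul, div_mul_cancel₀ _ hc', mul_comm]

theorem mem_affineCopy_of_norm_sub_lt {s : ℝ} (hs : s ≠ 0) {a z : ℂ}
    (h : ‖z - a‖ < φ / 2 * |s|) : z ∈ affineCopy s a := by
  rw [mem_affineCopy_iff hs]
  apply ball_subset_pentagon
  rwa [mem_ball_zero_iff, norm_div, Complex.norm_real, Real.norm_eq_abs,
    div_lt_iff₀ (abs_pos.2 hs)]

theorem norm_sub_le_of_mem_affineCopy {s : ℝ} {a z : ℂ} (h : z ∈ affineCopy s a) :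
    ‖z - a‖ ≤ |s| := by
  obtain ⟨w, hw, rfl⟩ := h
  rw [add_sub_cancel_right, norm_mul, Complex.norm_real, Real.norm_eq_abs]
  exact mul_le_of_le_one_right (abs_nonneg s)
    (mem_closedBall_zero_iff.1 (pentagon_subset_closedBall hw))

/-- The scaling factor `windowScale` as a function of the residue class modulo `5`; it vanishes
at `0`. -/
def residueScale (k : ZMod 5) : ℝ := windowScale k.val

theorem residueScale_one : residueScale 1 = 1 := rfl

theorem residueScale_two : residueScale 2 = -φ := rfl

theorem residueScale_neg (k : ZMod 5) : residueScale (-k) = -residueScale k := by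
  have hval : ∀ l : ZMod 5, l = 0 ∨ l = 1 ∨ l = 2 ∨ l = 3 ∨ l = 4 := by decide
  rcases hval k with rfl | rfl | rfl | rfl | rfl
  · exact neg_zero.symm
  · rfl
  · exact (neg_neg φ).symm
  · rfl
  · exact (neg_neg 1).symm

theorem eq_one_or_two_or_neg {k : ZMod 5} (hk : k ≠ 0) : k = 1 ∨ k = -1 ∨ k = 2 ∨ k = -2 := by
  revert k
  decide

theorem abs_residueScale {k : ZMod 5} (hk : k ≠ 0) :
    |residueScale k| = 1 ∨ |residueScale k| = φ := by
  have hφ : |-φ| = φ := by rw [abs_neg, abs_of_pos Real.goldenRatio_pos]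
  rcases eq_one_or_two_or_neg hk with rfl | rfl | rfl | rfl <;>
    simp only [residueScale_neg, abs_neg, residueScale_one, residueScale_two, abs_one, hφ,
      true_or, or_true]

theorem one_le_abs_residueScale {k : ZMod 5} (hk : k ≠ 0) : 1 ≤ |residueScale k| := by
  rcases abs_residueScale hk with h | h <;> linarith [Real.one_lt_goldenRatio]

theorem abs_residueScale_le {k : ZMod 5} (hk : k ≠ 0) : |residueScale k| ≤ φ := by
  rcases abs_residueScale hk with h | h <;> linarith [Real.one_lt_goldenRatio]

theorem residueScale_ne_zero {k : ZMod 5} (hk : k ≠ 0) : residueScale k ≠ 0 :=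
  abs_pos.1 (one_pos.trans_le (one_le_abs_residueScale hk))

/-- The window `𝒲_{k,ε}` of the residue class `k`. -/
def residueWindow (k : ZMod 5) (ε : ℂ) : Set ℂ := affineCopy (residueScale k) ε

theorem residueWindow_natCast {k : ℕ} (hk : k < 5) (ε : ℂ) : residueWindow k ε = window k ε := by
  rw [residueWindow, residueScale, ZMod.val_natCast_of_lt hk]
  rfl

theorem mem_residueWindow_of_mul_mem {k l : ZMod 5} (hl : l ≠ 0) {ε z : ℂ} (hε : ‖ε‖ < 0.1)
    {c d : ℝ} (hcd : (|residueScale k| + 0.1) * |d| ≤ 0.7 * |c|)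
    (hz : (c : ℂ) * z ∈ residueWindow k ε) : (d : ℂ) * z ∈ residueWindow l ε := by
  have hc : |c| * ‖z‖ < |residueScale k| + 0.1 := by
    rw [← Real.norm_eq_abs, ← Complex.norm_real, ← norm_mul]
    linarith [norm_sub_le_of_mem_affineCopy hz, norm_sub_norm_le (c * z) ε]
  have hd : ‖(d : ℂ) * z‖ < 0.7 := by
    rw [norm_mul, Complex.norm_real, Real.norm_eq_abs]
    refine lt_of_mul_lt_mul_left ?_ (show 0 ≤ |residueScale k| + 0.1 by positivity)
    linarith [mul_le_mul_of_nonneg_right hcd (norm_nonneg z)]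
  refine mem_affineCopy_of_norm_sub_lt (residueScale_ne_zero hl) ?_
  have hscale : φ / 2 * 1 ≤ φ / 2 * |residueScale l| :=
    mul_le_mul_of_nonneg_left (one_le_abs_residueScale hl) (by positivity)
  linarith [norm_sub_le ((d : ℂ) * z) ε, goldenRatio_mem_Ioo.1]

theorem mod5_inv_tauUnit_sq : mod5 (↑tauUnit⁻¹ ^ 2) = -1 := by
  have hsq : (2 : ZMod 5) ^ 2 = -1 := by decide
  rw [map_pow, mod5_inv_tauUnit, hsq]

theorem conj_inv_tauUnit_sq : conj (↑tauUnit⁻¹ ^ 2) = φ ^ 2 := by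
  rw [map_pow, conj_inv_tauUnit, neg_sq]

/-- The part of the window of the residue class `k` that remains after discarding the internal
coordinates of those points that are hidden by their multiple by `τ⁻¹` or by `τ⁻²`. -/
def visibleWindow (k : ZMod 5) (ε : ℂ) : Set ℂ :=
  {z ∈ residueWindow k ε | ((-φ : ℝ) : ℂ) * z ∉ residueWindow (2 * k) ε ∧
    ((φ ^ 2 : ℝ) : ℂ) * z ∉ residueWindow (-k) ε}

/-! ### Visible points are the primitive points in the visible windows -/

theorem penroseSet_eq_image (ε : ℂ) : penroseSet ε =
    physical '' {x | residue x ≠ 0 ∧ internal x ∈ residueWindow (residue x) ε} := by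
  have hcast : ∀ k ∈ Finset.Icc 1 4, ((k : ℕ) : ZMod 5) ≠ 0 := by decide
  have hval : ∀ k : ZMod 5, k ≠ 0 → k.val ∈ Finset.Icc 1 4 := by decide
  ext z
  simp only [penroseSet, Set.mem_iUnion, lambdaSet_eq_image]
  constructor
  · rintro ⟨k, hk, x, ⟨hr, hi⟩, rfl⟩
    refine ⟨x, ⟨hr ▸ hcast k hk, ?_⟩, rfl⟩
    rwa [hr, residueWindow_natCast (by simp at hk; lia)]
  · rintro ⟨x, ⟨hr, hi⟩, rfl⟩
    exact ⟨(residue x).val, hval _ hr, x, ⟨(ZMod.natCast_zmod_val _).symm, hi⟩, rfl⟩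

theorem toReal_mul_physical_mem_penroseSet {ε : ℂ} {c : GoldenInt} {x : GoldenInt × GoldenInt}
    (hr : mod5 c * residue x ≠ 0)
    (hi : (conj c : ℂ) * internal x ∈ residueWindow (mod5 c * residue x) ε) :
    (toReal c : ℂ) * physical x ∈ penroseSet ε := by
  rw [penroseSet_eq_image, ← physical_smul]
  refine Set.mem_image_of_mem _ ⟨?_, ?_⟩
  · rwa [residue_smul]
  · rwa [residue_smul, internal_smul]

/-- The norm form `a² + ab - b²` only takes the values `0` and `±1` modulo `5`. -/
theorem GoldenInt.four_le_abs_norm {d : GoldenInt} (h0 : d ≠ 0) (hu : ¬ IsUnit d) :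
    4 ≤ |d.norm| := by
  have hmod : ∀ a b : ZMod 5, a * a + a * b - b * b = 0 ∨ a * a + a * b - b * b = 1 ∨
      a * a + a * b - b * b = -1 := by decide
  have hnorm : (d.norm : ZMod 5) = 0 ∨ (d.norm : ZMod 5) = 1 ∨ (d.norm : ZMod 5) = -1 := by
    rw [QuadraticAlgebra.norm_def]
    push_cast
    simpa only [one_mul] using hmod d.re d.im
  have hne0 : d.norm ≠ 0 := mt norm_eq_zero.1 h0
  have hne1 : |d.norm| ≠ 1 :=
    fun h ↦ hu (QuadraticAlgebra.isUnit_iff_norm_isUnit.2 (Int.isUnit_iff_abs_eq.2 h))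
  generalize d.norm = N at hnorm hne0 hne1
  by_contra! hlt
  obtain ⟨hlow, hupp⟩ := abs_lt.1 hlt
  interval_cases N <;> revert hnorm hne0 hne1 <;> decide

theorem exists_goldenRatio_zpow_lt_toReal {d : GoldenInt} (hpos : 0 < toReal d)
    (hu : ¬ IsUnit d) : ∃ n : ℤ, φ ^ n < toReal d ∧ 4 ≤ φ ^ (n + 1) * |conj d| := by
  obtain ⟨n, hlt, hle⟩ := exists_mem_Ioc_zpow hpos Real.one_lt_goldenRatio
  have hd : d ≠ 0 := by
    rintro rfl
    simp at hpos
  refine ⟨n, hlt, ?_⟩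
  calc (4 : ℝ) ≤ toReal d * |conj d| := by
        rw [← abs_of_pos hpos, ← abs_mul, toReal_mul_conj]
        exact_mod_cast four_le_abs_norm hd hu
    _ ≤ φ ^ (n + 1) * |conj d| := mul_le_mul_of_nonneg_right hle (abs_nonneg _)

theorem exists_eq_smul_of_not_isCoprime {x : GoldenInt × GoldenInt} (hx : ¬ IsCoprime x.1 x.2) :
    ∃ d y, 0 ≤ toReal d ∧ ¬ IsUnit d ∧ x = d • y := by
  obtain ⟨a, ha⟩ := EuclideanDomain.gcd_dvd_left x.1 x.2
  obtain ⟨b, hb⟩ := EuclideanDomain.gcd_dvd_right x.1 x.2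
  rw [← EuclideanDomain.gcd_isUnit_iff] at hx
  generalize EuclideanDomain.gcd x.1 x.2 = d at ha hb hx
  rcases le_total 0 (toReal d) with hd | hd
  · exact ⟨d, (a, b), hd, hx, Prod.ext ha hb⟩
  · refine ⟨-d, (-a, -b), by simpa using hd, by rwa [IsUnit.neg_iff], Prod.ext ?_ ?_⟩
    · simpa using ha
    · simpa using hb

/-- A common factor `d` that is not a unit has norm at least `4`, so `x` is hidden by the multiple
`τⁿ • y` of `y = d⁻¹ • x` with `τⁿ < d ≤ τⁿ⁺¹`, whose internal coordinate is small. -/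
theorem isCoprime_of_physical_mem_visible {ε : ℂ} (hε : ‖ε‖ < 0.1) {x : GoldenInt × GoldenInt}
    (hr : residue x ≠ 0) (hi : internal x ∈ residueWindow (residue x) ε)
    (hx : physical x ∈ visible (penroseSet ε)) : IsCoprime x.1 x.2 := by
  by_contra hcop
  obtain ⟨d, y, hnonneg, hu, rfl⟩ := exists_eq_smul_of_not_isCoprime hcop
  have hd : d ≠ 0 := by
    rintro rfl
    simp at hr
  have hpos : 0 < toReal d := hnonneg.lt_of_ne' (toReal_ne_zero hd)
  obtain ⟨n, hlt, hconj⟩ := exists_goldenRatio_zpow_lt_toReal hpos hu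
  have hn : 0 < φ ^ n := zpow_pos Real.goldenRatio_pos n
  have hscale := abs_residueScale_le hr
  rw [internal_smul] at hi
  have hry : mod5 ↑(tauUnit ^ n) * residue y ≠ 0 :=
    mul_ne_zero ((tauUnit ^ n).isUnit.map mod5).ne_zero
      (right_ne_zero_of_mul (residue_smul d y ▸ hr))
  refine hx.2 (φ ^ n / toReal d) (by positivity) ((div_lt_one hpos).2 hlt) ?_
  have hphysical : ((φ ^ n / toReal d : ℝ) : ℂ) * physical (d • y)
      = (toReal ↑(tauUnit ^ n) : ℂ) * physical y := by
    rw [toReal_tauUnit_zpow, physical_smul, ← mul_assoc, ← Complex.ofReal_mul,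
      div_mul_cancel₀ _ hpos.ne']
  rw [hphysical]
  refine toReal_mul_physical_mem_penroseSet hry (mem_residueWindow_of_mul_mem hry hε ?_ hi)
  rw [abs_conj_tauUnit_zpow, mul_inv_le_iff₀ hn]
  rw [zpow_add_one₀ Real.goldenRatio_ne_zero] at hconj
  have hφ := goldenRatio_mem_Ioo
  have hfactor : φ * (φ + 0.1) ≤ 0.7 * 4 := by linarith [hφ.2, Real.goldenRatio_sq]
  refine le_of_mul_le_mul_left ?_ Real.goldenRatio_pos
  linarith [mul_le_mul_of_nonneg_left hscale Real.goldenRatio_pos.le]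

theorem internal_mem_visibleWindow {ε : ℂ} {x : GoldenInt × GoldenInt} (hr : residue x ≠ 0)
    (hi : internal x ∈ residueWindow (residue x) ε) (hx : physical x ∈ visible (penroseSet ε)) :
    internal x ∈ visibleWindow (residue x) ε := by
  have hinv : toReal ↑tauUnit⁻¹ ∈ Set.Ioo 0 1 := by
    rw [toReal_inv_tauUnit]
    exact ⟨inv_pos.2 Real.goldenRatio_pos, inv_lt_one_of_one_lt₀ Real.one_lt_goldenRatio⟩
  refine ⟨hi, fun hmem ↦ ?_, fun hmem ↦ ?_⟩
  · rw [← conj_inv_tauUnit, ← mod5_inv_tauUnit] at hmem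
    refine hx.2 _ hinv.1 hinv.2 (toReal_mul_physical_mem_penroseSet ?_ hmem)
    exact mul_ne_zero (mod5_inv_tauUnit ▸ by decide) hr
  · rw [← conj_inv_tauUnit_sq, ← neg_one_mul, ← mod5_inv_tauUnit_sq] at hmem
    refine hx.2 _ ?_ ?_ (toReal_mul_physical_mem_penroseSet ?_ hmem)
    · rw [map_pow]
      exact pow_pos hinv.1 2
    · rw [map_pow]
      exact pow_lt_one₀ hinv.1.le hinv.2 two_ne_zero
    · exact mul_ne_zero (mod5_inv_tauUnit_sq ▸ by decide) hr

/-- The multiples of a primitive point that lie on the segment to the origin are those by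
`t ∈ ℤ[τ] ∩ (0, 1)`, and all but `τ⁻¹` and `τ⁻²` have a large conjugate. -/
theorem physical_mem_visible {ε : ℂ} (hε : ‖ε‖ < 0.1) {x : GoldenInt × GoldenInt}
    (hcop : IsCoprime x.1 x.2) (hr : residue x ≠ 0)
    (hi : internal x ∈ visibleWindow (residue x) ε) : physical x ∈ visible (penroseSet ε) := by
  obtain ⟨hi, hi₁, hi₂⟩ := hi
  refine ⟨penroseSet_eq_image ε ▸ ⟨x, ⟨hr, hi⟩, rfl⟩, fun t ht0 ht1 hmem ↦ ?_⟩
  rw [penroseSet_eq_image] at hmem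
  obtain ⟨y, ⟨hyr, hyi⟩, hy⟩ := hmem
  obtain ⟨c, rfl, rfl⟩ := exists_eq_smul_of_isCoprime hcop hy.symm
  have hscale := abs_residueScale_le hyr
  rw [residue_smul] at hyr hscale
  rw [residue_smul, internal_smul] at hyi
  rcases eq_inv_tauUnit_or_le_abs_conj ht0 ht1 with rfl | rfl | hc
  · rw [mod5_inv_tauUnit, conj_inv_tauUnit] at hyi
    exact hi₁ hyi
  · rw [mod5_inv_tauUnit_sq, conj_inv_tauUnit_sq, neg_one_mul] at hyi
    exact hi₂ hyi
  · refine hi₁ (mem_residueWindow_of_mul_mem (mul_ne_zero (by decide) hr) hε ?_ hyi)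
    rw [abs_neg, abs_of_pos Real.goldenRatio_pos]
    have hφ := goldenRatio_mem_Ioo
    have hcube : φ ^ 3 = 2 * φ + 1 := by linear_combination (φ + 1) * Real.goldenRatio_sq
    linarith [mul_le_mul_of_nonneg_right hscale Real.goldenRatio_pos.le, Real.goldenRatio_sq,
      hφ.1, hφ.2]

theorem visible_penroseSet {ε : ℂ} (hε : ‖ε‖ < 0.1) : visible (penroseSet ε) =
    physical '' {x | IsCoprime x.1 x.2 ∧ residue x ≠ 0 ∧
      internal x ∈ visibleWindow (residue x) ε} := by
  refine Set.Subset.antisymm (fun z hz ↦ ?_) ?_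
  · obtain ⟨x, ⟨hr, hi⟩, rfl⟩ := penroseSet_eq_image ε ▸ hz.1
    exact ⟨x, ⟨isCoprime_of_physical_mem_visible hε hr hi hz, hr,
      internal_mem_visibleWindow hr hi hz⟩, rfl⟩
  · rintro _ ⟨x, ⟨hcop, hr, hi⟩, rfl⟩
    exact physical_mem_visible hε hcop hr hi

/-! ### Jordan measurability of the windows -/

namespace JordanMeasurable

variable {A B : Set ℂ}

theorem union (hA : JordanMeasurable A) (hB : JordanMeasurable B) : JordanMeasurable (A ∪ B) :=
  ⟨hA.1.union hB.1, measure_mono_null ((frontier_union_subset A B).trans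
    (Set.union_subset_union Set.inter_subset_left Set.inter_subset_right))
    (measure_union_null hA.2 hB.2)⟩

theorem diff (hA : JordanMeasurable A) (hB : JordanMeasurable B) : JordanMeasurable (A \ B) := by
  refine ⟨hA.1.subset Set.sdiff_subset, measure_mono_null ?_ (measure_union_null hA.2 hB.2)⟩
  rw [Set.sdiff_eq, ← frontier_compl B]
  exact (frontier_inter_subset A Bᶜ).trans
    (Set.union_subset_union Set.inter_subset_left Set.inter_subset_right)

end JordanMeasurable

theorem measurableSet_affineCopy {s : ℝ} (hs : s ≠ 0) (a : ℂ) :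
    MeasurableSet (affineCopy s a) := by
  have hpreimage : affineCopy s a = (fun z ↦ (z - a) / s) ⁻¹' pentagon :=
    Set.ext fun z ↦ mem_affineCopy_iff hs
  rw [hpreimage]
  exact (isOpen_interior.preimage (by fun_prop)).measurableSet

theorem jordanMeasurable_affineCopy (s : ℝ) (a : ℂ) : JordanMeasurable (affineCopy s a) := by
  constructor
  · exact (Metric.isBounded_closedBall (x := a) (r := |s|)).subset fun z hz ↦
      mem_closedBall_iff_norm.2 (norm_sub_le_of_mem_affineCopy hz)
  · have himage : affineCopy s a = (fun w ↦ a + s • w) '' pentagon := by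
      simp only [affineCopy, Complex.real_smul, add_comm]
    rw [himage]
    exact ((convex_convexHull ℝ _).interior.affinity a s).addHaar_frontier volume

theorem visibleWindow_eq_diff {k : ZMod 5} (hk : k ≠ 0) (ε : ℂ) :
    visibleWindow k ε = residueWindow k ε \
      (affineCopy (residueScale (2 * k) / -φ) (ε / (-φ : ℝ)) ∪
        affineCopy (-residueScale k / φ ^ 2) (ε / (φ ^ 2 : ℝ))) := by
  have hφ := Real.goldenRatio_ne_zero
  have h2k : 2 * k ≠ 0 := mul_ne_zero (by decide) hk
  ext z
  rw [Set.mem_sdiff, Set.mem_union, not_or,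
    ← mul_mem_affineCopy_iff (neg_ne_zero.2 hφ) (residueScale_ne_zero h2k),
    ← mul_mem_affineCopy_iff (pow_ne_zero 2 hφ) (neg_ne_zero.2 (residueScale_ne_zero hk)),
    ← residueScale_neg]
  rfl

theorem jordanMeasurable_visibleWindow {k : ZMod 5} (hk : k ≠ 0) (ε : ℂ) :
    JordanMeasurable (visibleWindow k ε) := by
  rw [visibleWindow_eq_diff hk]
  exact (jordanMeasurable_affineCopy _ _).diff
    ((jordanMeasurable_affineCopy _ _).union (jordanMeasurable_affineCopy _ _))

/-! ### Areas of the visible windows -/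

theorem measureReal_smul_complex (T : ℝ) (D : Set ℂ) :
    volume.real (T • D) = T ^ 2 * volume.real D := by
  rw [Measure.real, Measure.addHaar_smul, Complex.finrank_real_complex, ENNReal.toReal_mul,
    ENNReal.toReal_ofReal (abs_nonneg _), abs_of_nonneg (sq_nonneg T), Measure.real]

theorem measureReal_image_ofReal_mul_add (s : ℝ) (a : ℂ) (E : Set ℂ) :
    volume.real ((fun w : ℂ ↦ (s : ℂ) * w + a) '' E) = s ^ 2 * volume.real E := by
  have himage : (fun w : ℂ ↦ (s : ℂ) * w + a) '' E = (· + -a) ⁻¹' (s • E) := by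
    rw [← Set.image_add_right, ← Set.image_smul, Set.image_image]
    rfl
  rw [himage, Measure.real, measure_preimage_add_right, ← Measure.real, measureReal_smul_complex]

/-- The area of the overlap of the pentagon with its translate by `c`. -/
def overlap (c : ℂ) : ℝ := volume.real (pentagon ∩ (fun w : ℂ ↦ w + c) '' pentagon)

theorem measureReal_affineCopy (s : ℝ) (a : ℂ) :
    volume.real (affineCopy s a) = s ^ 2 * volume.real pentagon :=
  measureReal_image_ofReal_mul_add s a pentagon

theorem measureReal_affineCopy_inter {s : ℝ} (hs : s ≠ 0) (a b : ℂ) :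
    volume.real (affineCopy s a ∩ affineCopy s b) = s ^ 2 * overlap ((b - a) / s) := by
  have hs' : (s : ℂ) ≠ 0 := mod_cast hs
  have hinj : Function.Injective fun w : ℂ ↦ (s : ℂ) * w + a :=
    (add_left_injective a).comp (mul_right_injective₀ hs')
  have hb : affineCopy s b =
      (fun w : ℂ ↦ (s : ℂ) * w + a) '' ((fun w ↦ w + (b - a) / s) '' pentagon) := by
    rw [affineCopy, Set.image_image]
    simp only [mul_add, mul_div_cancel₀ _ hs', add_assoc, sub_add_cancel]
  rw [overlap, ← measureReal_image_ofReal_mul_add s a, Set.image_inter hinj, ← hb, affineCopy]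

theorem overlap_neg (c : ℂ) : overlap (-c) = overlap c := by
  have hcomm := congrArg volume.real (Set.inter_comm (affineCopy 1 0) (affineCopy 1 c))
  rw [measureReal_affineCopy_inter one_ne_zero, measureReal_affineCopy_inter one_ne_zero] at hcomm
  simpa using hcomm.symm

theorem overlap_eq_of_sq_eq_sq {c d : ℂ} (h : c ^ 2 = d ^ 2) : overlap c = overlap d := by
  rcases sq_eq_sq_iff_eq_or_eq_neg.1 h with rfl | rfl
  · rfl
  · exact overlap_neg d

theorem measureReal_affineCopy_sdiff {s : ℝ} (hs : s ≠ 0) (a b : ℂ) :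
    volume.real (affineCopy s a \ affineCopy s b) =
      s ^ 2 * (volume.real pentagon - overlap ((b - a) / s)) := by
  have hsplit := measureReal_inter_add_sdiff (μ := volume) (s := affineCopy s a)
    (measurableSet_affineCopy hs b) (jordanMeasurable_affineCopy s a).1.measure_lt_top.ne
  rw [measureReal_affineCopy_inter hs, measureReal_affineCopy] at hsplit
  linear_combination hsplit

theorem measureReal_affineCopy_union {s : ℝ} (hs : s ≠ 0) (a b : ℂ) :
    volume.real (affineCopy s a ∪ affineCopy s b) =
      s ^ 2 * (2 * volume.real pentagon - overlap ((b - a) / s)) := by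
  have hsum := measureReal_union_add_inter (μ := volume) (s := affineCopy s a)
    (measurableSet_affineCopy hs b) (jordanMeasurable_affineCopy s a).1.measure_lt_top.ne
    (jordanMeasurable_affineCopy s b).1.measure_lt_top.ne
  rw [measureReal_affineCopy_inter hs, measureReal_affineCopy, measureReal_affineCopy] at hsum
  linear_combination hsum

theorem residueScale_of_eq_one_or {k : ZMod 5} (hk : k = 1 ∨ k = -1) :
    |residueScale k| = 1 ∧ residueScale (2 * k) = residueScale k * -φ := by
  rcases hk with rfl | rfl
  · simp [residueScale_one, residueScale_two]
  · simp [residueScale_neg, residueScale_one, residueScale_two]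

theorem residueScale_of_eq_two_or {k : ZMod 5} (hk : k = 2 ∨ k = -2) :
    |residueScale k| = φ ∧ residueScale (2 * k) = residueScale k / φ := by
  have hφ := Real.goldenRatio_pos
  have h4 : (2 * 2 : ZMod 5) = -1 := by decide
  rcases hk with rfl | rfl
  · simp [h4, residueScale_neg, residueScale_one, residueScale_two, hφ.le, hφ.ne']
  · simp [h4, residueScale_neg, residueScale_one, residueScale_two, hφ.le, hφ.ne']

section Area

variable {k : ZMod 5} {ε : ℂ}

theorem visibleWindow_of_eq_one_or (hk : k = 1 ∨ k = -1) (hε : ‖ε‖ < 0.1) : visibleWindow k ε =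
    affineCopy (residueScale k) ε \ affineCopy (residueScale k) (ε / (-φ : ℝ)) := by
  have hφ := Real.goldenRatio_ne_zero
  have hk0 : k ≠ 0 := by rcases hk with rfl | rfl <;> decide
  have h2k : 2 * k ≠ 0 := mul_ne_zero (by decide) hk0
  obtain ⟨habs, htwo⟩ := residueScale_of_eq_one_or hk
  have hsub : affineCopy (-residueScale k / φ ^ 2) (ε / (φ ^ 2 : ℝ)) ⊆
      affineCopy (residueScale (2 * k) / -φ) (ε / (-φ : ℝ)) := by
    intro z hz
    rw [← residueScale_neg, ← mul_mem_affineCopy_iff (pow_ne_zero 2 hφ)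
      (residueScale_ne_zero (neg_ne_zero.2 hk0))] at hz
    rw [← mul_mem_affineCopy_iff (neg_ne_zero.2 hφ) (residueScale_ne_zero h2k)]
    refine mem_residueWindow_of_mul_mem h2k hε ?_ hz
    rw [residueScale_neg, abs_neg, habs, abs_neg, abs_of_pos Real.goldenRatio_pos,
      abs_of_nonneg (sq_nonneg φ), Real.goldenRatio_sq]
    linarith [goldenRatio_mem_Ioo.2]
  rw [visibleWindow_eq_diff hk0, Set.union_eq_self_of_subset_right hsub, htwo,
    mul_div_cancel_right₀ _ (neg_ne_zero.2 hφ), residueWindow]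

theorem measureReal_visibleWindow_of_eq_one_or (hk : k = 1 ∨ k = -1) (hε : ‖ε‖ < 0.1) :
    volume.real (visibleWindow k ε) = volume.real pentagon - overlap (φ * ε) := by
  obtain ⟨habs, -⟩ := residueScale_of_eq_one_or hk
  have hsq : residueScale k ^ 2 = 1 := by rw [← sq_abs, habs, one_pow]
  have hs : residueScale k ≠ 0 := by
    intro h
    simp [h] at habs
  have hshift : ((ε / (-φ : ℝ) - ε) / residueScale k) ^ 2 = ((φ : ℂ) * ε) ^ 2 := by
    have hφ : (φ : ℂ) ≠ 0 := mod_cast Real.goldenRatio_ne_zero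
    have hsq' : (residueScale k : ℂ) ^ 2 = 1 := mod_cast hsq
    have hinv : ε / (-φ : ℝ) - ε = -(φ * ε) := by
      rw [Complex.ofReal_neg, div_neg, sub_eq_iff_eq_add, neg_eq_iff_eq_neg, div_eq_iff hφ]
      linear_combination -ε * ofReal_goldenRatio_sq
    rw [hinv, div_pow, hsq', div_one, neg_sq]
  rw [visibleWindow_of_eq_one_or hk hε, measureReal_affineCopy_sdiff hs, hsq, one_mul,
    overlap_eq_of_sq_eq_sq hshift]

theorem visibleWindow_of_eq_two_or (hk : k = 2 ∨ k = -2) (hε : ‖ε‖ < 0.1) :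
    ∃ s : ℝ, s ^ 2 = (φ ^ 2)⁻¹ ∧
      affineCopy s (ε / (-φ : ℝ)) ∪ affineCopy s (ε / (φ ^ 2 : ℝ)) ⊆ residueWindow k ε ∧
      visibleWindow k ε = residueWindow k ε \
        (affineCopy s (ε / (-φ : ℝ)) ∪ affineCopy s (ε / (φ ^ 2 : ℝ))) := by
  have hφ := Real.goldenRatio_ne_zero
  have hk0 : k ≠ 0 := by rcases hk with rfl | rfl <;> decide
  have h2k : 2 * k ≠ 0 := mul_ne_zero (by decide) hk0
  obtain ⟨habs, htwo⟩ := residueScale_of_eq_two_or hk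
  have hs : residueScale (2 * k) / -φ = -residueScale k / φ ^ 2 := by
    rw [htwo, div_div, mul_neg, ← sq, div_neg, neg_div]
  have hone (z : ℂ) : z = ((1 : ℝ) : ℂ) * z := by rw [Complex.ofReal_one, one_mul]
  refine ⟨-residueScale k / φ ^ 2, ?_, Set.union_subset (fun z hz ↦ ?_) (fun z hz ↦ ?_), ?_⟩
  · rw [div_pow, neg_sq, ← sq_abs, habs]
    field_simp
  · rw [← hs, ← mul_mem_affineCopy_iff (neg_ne_zero.2 hφ) (residueScale_ne_zero h2k)] at hz
    rw [hone z]
    refine mem_residueWindow_of_mul_mem hk0 hε ?_ hz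
    rw [htwo, abs_div, habs, abs_neg, abs_of_pos Real.goldenRatio_pos, div_self hφ, abs_one]
    linarith [goldenRatio_mem_Ioo.1]
  · rw [← residueScale_neg, ← mul_mem_affineCopy_iff (pow_ne_zero 2 hφ)
      (residueScale_ne_zero (neg_ne_zero.2 hk0))] at hz
    rw [hone z]
    refine mem_residueWindow_of_mul_mem hk0 hε ?_ hz
    rw [residueScale_neg, abs_neg, habs, abs_one, abs_of_nonneg (sq_nonneg φ), Real.goldenRatio_sq]
    linarith [goldenRatio_mem_Ioo.1, goldenRatio_mem_Ioo.2]
  · rw [visibleWindow_eq_diff hk0, hs]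

theorem measureReal_visibleWindow_of_eq_two_or (hk : k = 2 ∨ k = -2) (hε : ‖ε‖ < 0.1) :
    volume.real (visibleWindow k ε) = φ ^ 2 * volume.real pentagon -
      (φ ^ 2)⁻¹ * (2 * volume.real pentagon - overlap (φ * ε)) := by
  obtain ⟨s, hsq, hsub, hvis⟩ := visibleWindow_of_eq_two_or hk hε
  have hs : s ≠ 0 := by
    rw [← sq_pos_iff, hsq]
    exact inv_pos.2 (pow_pos Real.goldenRatio_pos 2)
  have hshift : ((ε / (φ ^ 2 : ℝ) - ε / (-φ : ℝ)) / s) ^ 2 = ((φ : ℂ) * ε) ^ 2 := by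
    have hφ : (φ : ℂ) ≠ 0 := mod_cast Real.goldenRatio_ne_zero
    have hsq' : (s : ℂ) ^ 2 = ((φ : ℂ) ^ 2)⁻¹ := mod_cast hsq
    have hsum : ε / (φ ^ 2 : ℝ) - ε / (-φ : ℝ) = ε := by
      rw [Complex.ofReal_pow, Complex.ofReal_neg, div_neg, sub_neg_eq_add,
        div_add_div _ _ (pow_ne_zero 2 hφ) hφ, div_eq_iff (mul_ne_zero (pow_ne_zero 2 hφ) hφ)]
      linear_combination -ε * φ * ofReal_goldenRatio_sq
    rw [hsum, div_pow, hsq', div_inv_eq_mul, mul_pow, mul_comm]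
  rw [hvis, measureReal_sdiff hsub
    ((measurableSet_affineCopy hs _).union (measurableSet_affineCopy hs _))
    ((jordanMeasurable_affineCopy _ _).1.measure_lt_top.ne), measureReal_affineCopy_union hs,
    overlap_eq_of_sq_eq_sq hshift, hsq, residueWindow, measureReal_affineCopy, ← sq_abs,
    (residueScale_of_eq_two_or hk).1]

theorem sum_measureReal_visibleWindow (hε : ‖ε‖ < 0.1) :
    ∑ k ∈ Finset.univ.erase (0 : ZMod 5), volume.real (visibleWindow k ε) =
      2 * φ⁻¹ * ((3 + φ) * volume.real pentagon - overlap (φ * ε)) := by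
  have herase : Finset.univ.erase (0 : ZMod 5) = {1, -1, 2, -2} := by decide
  have hinv : φ⁻¹ = φ - 1 := by
    rw [Real.inv_goldenRatio, ← Real.one_sub_goldenConj, neg_sub]
  have hinv_sq : (φ ^ 2)⁻¹ = 2 - φ := by
    rw [← inv_pow, hinv]
    linear_combination Real.goldenRatio_sq
  rw [herase, Finset.sum_insert (by decide), Finset.sum_insert (by decide),
    Finset.sum_insert (by decide), Finset.sum_singleton,
    measureReal_visibleWindow_of_eq_one_or (.inl rfl) hε,
    measureReal_visibleWindow_of_eq_one_or (.inr rfl) hε,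
    measureReal_visibleWindow_of_eq_two_or (.inl rfl) hε,
    measureReal_visibleWindow_of_eq_two_or (.inr rfl) hε, hinv, hinv_sq,
    Real.goldenRatio_sq]
  linear_combination (-2 * volume.real pentagon) * Real.goldenRatio_sq

end Area

/-! ### The density of the visible points -/

theorem visible_penroseSet_inter_smul {ε : ℂ} (hε : ‖ε‖ < 0.1) (D : Set ℂ) (T : ℝ) :
    visible (penroseSet ε) ∩ T • D = physical ''
      ⋃ k ∈ (Finset.univ.erase (0 : ZMod 5) : Set (ZMod 5)),
        {x ∈ region k D (visibleWindow k ε) T | IsCoprime x.1 x.2} := by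
  rw [visible_penroseSet hε]
  ext z
  simp only [Set.mem_inter_iff, Set.mem_image, Set.mem_iUnion]
  constructor
  · rintro ⟨⟨x, ⟨hcop, hr, hi⟩, rfl⟩, hD⟩
    exact ⟨x, ⟨residue x, by simpa using hr, ⟨rfl, hD, hi⟩, hcop⟩, rfl⟩
  · rintro ⟨x, ⟨k, hk, ⟨rfl, hD, hi⟩, hcop⟩, rfl⟩
    exact ⟨⟨x, ⟨hcop, by simpa using hk, hi⟩, rfl⟩, hD⟩

theorem finite_region_visibleWindow {k : ZMod 5} (hk : k ≠ 0) (ε : ℂ) {D : Set ℂ}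
    (hD : Bornology.IsBounded D) {T : ℝ} (hT : 0 < T) :
    {x ∈ region k D (visibleWindow k ε) T | IsCoprime x.1 x.2}.Finite :=
  (finite_region hk hD (jordanMeasurable_visibleWindow hk ε).1 hT).subset (Set.sep_subset _ _)

theorem ncard_visible_penroseSet_inter_smul {ε : ℂ} (hε : ‖ε‖ < 0.1) {D : Set ℂ}
    (hD : Bornology.IsBounded D) {T : ℝ} (hT : 0 < T) :
    (visible (penroseSet ε) ∩ T • D).ncard = ∑ k ∈ Finset.univ.erase (0 : ZMod 5),
      {x ∈ region k D (visibleWindow k ε) T | IsCoprime x.1 x.2}.ncard := by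
  rw [visible_penroseSet_inter_smul hε, Set.ncard_image_of_injective _ physical_injective,
    (Finset.finite_toSet _).ncard_biUnion, finsum_mem_coe_finset]
  · exact fun k hk ↦ finite_region_visibleWindow (by simpa using hk) ε hD hT
  · exact fun k _ l _ hkl ↦ Set.disjoint_left.2 fun x hx hy ↦ hkl (hx.1.1.symm.trans hy.1.1)

theorem locFinite_visible_penroseSet {ε : ℂ} (hε : ‖ε‖ < 0.1) :
    LocFinite (visible (penroseSet ε)) := by
  intro B hB
  rw [← one_smul ℝ B, visible_penroseSet_inter_smul hε]
  refine ((Finset.finite_toSet _).biUnion fun k hk ↦ ?_).image _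
  exact finite_region_visibleWindow (by simpa using hk) ε hB one_pos

theorem hasDensity_visible_penroseSet {ε : ℂ} (hε : ‖ε‖ < 0.1) :
    HasDensity (visible (penroseSet ε))
      (∑ k ∈ Finset.univ.erase (0 : ZMod 5),
        volume.real (visibleWindow k ε) * (1 / (6 * √5)) / ∑' I, GoldenInt.normInvSq I) := by
  refine ⟨locFinite_visible_penroseSet hε, fun D hD hD0 ↦ ?_⟩
  have hvol : volume.real D ≠ 0 :=
    (ENNReal.toReal_pos hD0.ne' hD.1.measure_lt_top.ne).ne'
  have hlim := tendsto_finsetSum (Finset.univ.erase (0 : ZMod 5)) fun k hk ↦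
    (tendsto_ncard_region_isCoprime (Finset.ne_of_mem_erase hk) hD
      (jordanMeasurable_visibleWindow (Finset.ne_of_mem_erase hk) ε)).div_const (volume.real D)
  simp only [mul_assoc, mul_div_assoc, mul_div_cancel_left₀ _ hvol] at hlim ⊢
  refine hlim.congr' ?_
  filter_upwards [eventually_gt_atTop 0] with T hT
  rw [← Measure.real, measureReal_smul_complex, ncard_visible_penroseSet_inter_smul hε hD.1 hT,
    Nat.cast_sum, Finset.sum_div]
  exact Finset.sum_congr rfl fun k _ ↦ div_div _ _ _

theorem sum_visibleWindow_div {ε : ℂ} (hε : ‖ε‖ < 0.1) (Z : ℝ) :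
    ∑ k ∈ Finset.univ.erase (0 : ZMod 5), volume.real (visibleWindow k ε) * (1 / (6 * √5)) / Z =
      ((3 + φ) * volume.real pentagon - overlap (φ * ε)) / (3 * (φ + 2) * Z) := by
  have hsqrt : φ * √5 = φ + 2 := by
    rw [Real.goldenRatio]
    linear_combination Real.mul_self_sqrt (show (0 : ℝ) ≤ 5 by norm_num) / 2
  rw [← Finset.sum_div, ← Finset.sum_mul, sum_measureReal_visibleWindow hε, ← hsqrt]
  field_simp
  ring

end PenroseVisible

end

theorem mainTheorem4 (ε : ℂ) (hε : ‖ε‖ < 0.1) :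
    ∃ θ : ℝ,
      PenroseVisible.HasDensity (PenroseVisible.visible (PenroseVisible.penroseSet ε)) θ ∧
      (θ : ℂ) =
        (((3 + PenroseVisible.tau) * (volume PenroseVisible.pentagon).toReal -
            (volume (PenroseVisible.pentagon ∩
              (fun w : ℂ => w + (PenroseVisible.tau : ℂ) * ε) ''
                PenroseVisible.pentagon)).toReal : ℝ) : ℂ) /
          (3 * ((PenroseVisible.tau : ℂ) + 2) *
            NumberField.dedekindZeta PenroseVisible.QSqrtFive 2) := by
  refine ⟨_, PenroseVisible.hasDensity_visible_penroseSet hε, ?_⟩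
  rw [PenroseVisible.sum_visibleWindow_div hε, PenroseVisible.GoldenInt.dedekindZeta_two,
    PenroseVisible.overlap, Measure.real, Measure.real]
  push_cast
  rfl
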